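/- Let $p\ge 5$ be a prime. For $n\ge 0$ let $\mu_{p^{n+1}}$ be the group of $p^{n+1}$-th roots of unity in an algebraic closure of $\mathbb Q_p$, and put $K_n=\mathbb Q_p(\mu_{p^{n+1}})$, $\Gamma_n=\mathrm{Gal}(K_n/K_0)$, $\Delta=\mathrm{Gal}(K_0/\mathbb Q_p)$. For $u\in\mathbb Z_p^*$ write $u=\omega(u)\langle u\rangle$ with $\omega(u)^{p-1}=1$ and $\langle u\rangle\equiv 1 \pmod p$, and let $\gamma_n(u)\in\Gamma_n$ be the automorphism with $\zeta\mapsto\zeta^{\langle u\rangle}$ for $\zeta\in\mu_{p^{n+1}}$. For a character $\theta:\Delta\to\mu_{p-1}\subset\mathbb Z_p^*$ let $\theta(u)$ be its value at the element of $\Delta$ with $\zeta\mapsto\zeta^{u}$ on $\mu_p$; $\theta$ is called odd if $\theta(-1)=-1$. Let $L/\mathbb Q_p$ be a finite extension with valuation ring $O_L$ and uniformizer $\pi_L$, let $\theta:\Delta\to\mu_{p-1}$ be a character, and let $a\in O_L$ with $a(a-1)\not\equiv 0\pmod{\pi_L}$. For $n\ge 0$ set $$M_n(\theta,a)=\sum_{\substack{1\le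 k\le p^{n+1}-1\\ p\nmid k}}\frac{a^k}{a^{p^{n+1}}-1}\,\theta(k)\,\omega(k)^{-1}\,\gamma_n(k)\in O_L[\Gamma_n].$$ Then there is a unique power series $M(T,\theta,a)\in O_L[[T]]$ corresponding to $(M_n(\theta,a))_{n\ge0}$ under the isomorphism $O_L[[T]]\simeq\varprojlim_n O_L[\Gamma_n]$ that sends $T$ to $\gamma_0-1$, where $\gamma_0$ acts on $p$-power roots of unity by $\zeta\mapsto\zeta^{1+p}$. (That is: for every $n\ge 0$, $M(T,\theta,a)$ is congruent modulo $(1+T)^{p^n}-1$ to a polynomial over $O_L$ whose value at $T=\gamma_0|_{K_n}-1$ is $M_n(\theta,a)$.) Its formal derivative satisfies $$M'(T,\theta,a)\equiv 0\pmod{\pi_L}\quad\Longleftrightarrow\quad a\equiv -1\pmod{\pi_L}\ \text{ and }\ \theta\text{ is odd}.$$ -/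

import Mathlib

open Polynomial

noncomputable section

namespace Mirimanoff

/-! ### The cyclotomic tower over `ℚ_p` -/

/-- `K_n = ℚ_p(μ_{p^{n+1}})`, inside a fixed algebraic closure of `ℚ_p`. -/
def K (p : ℕ) [Fact p.Prime] (n : ℕ) :
    IntermediateField ℚ_[p] (AlgebraicClosure ℚ_[p]) :=
  IntermediateField.adjoin ℚ_[p] {z | z ^ p ^ (n + 1) = 1}

theorem K_zero_le (p : ℕ) [Fact p.Prime] (n : ℕ) : K p 0 ≤ K p n := by
  refine IntermediateField.adjoin.mono _ _ _ fun z hz => ?_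
  obtain ⟨m, hm⟩ := pow_dvd_pow p (show 0 + 1 ≤ n + 1 by omega)
  simp only [Set.mem_ofPred_eq] at hz ⊢
  rw [hm, pow_mul, hz, one_pow]

/-- The field `K_n` regarded as an extension of `K_0`. -/
abbrev KOver (p : ℕ) [Fact p.Prime] (n : ℕ) :
    IntermediateField (K p 0) (AlgebraicClosure ℚ_[p]) :=
  IntermediateField.extendScalars (K_zero_le p n)

/-- `Δ = Gal(K_0/ℚ_p)`. -/
abbrev Delta (p : ℕ) [Fact p.Prime] : Type := K p 0 ≃ₐ[ℚ_[p]] K p 0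

/-- `Γ_n = Gal(K_n/K_0)`. -/
abbrev Gam (p : ℕ) [Fact p.Prime] (n : ℕ) : Type := KOver p n ≃ₐ[K p 0] KOver p n

/-- Exponentiation of a `p^m`-th root of unity `z` by a `p`-adic integer `u`: the power `z ^ k`
for a natural number `k ≡ u mod p^m`. -/
def powPadic {p : ℕ} [Fact p.Prime] {F : Type} [Monoid F] (m : ℕ) (z : F) (u : ℤ_[p]) : F :=
  z ^ (PadicInt.toZModPow m u).val

theorem cyclotomic_irreducible (p : ℕ) [Fact p.Prime] (n : ℕ) :
    Irreducible (cyclotomic (p ^ (n + 1)) ℚ_[p]) := by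
  have hp : p.Prime := Fact.out
  have hE := cyclotomic_prime_pow_comp_X_add_one_isEisensteinAt p n
  set f : ℤ[X] := (cyclotomic (p ^ (n + 1)) ℤ).comp (X + 1) with hf
  have hfm : f.Monic := (cyclotomic.monic _ ℤ).comp (monic_X_add_C 1) fun h => by
    simpa using (natDegree_X_add_C (1 : ℤ)).symm.trans h
  let φ : ℤ →+* ℤ_[p] := Int.castRingHom ℤ_[p]
  have hgm : (f.map φ).Monic := hfm.map φ
  have hdeg : (f.map φ).natDegree = f.natDegree := hfm.natDegree_map φ
  have key : ∀ (m : ℕ) (z : ℤ), ((z : ℤ_[p]) ∈ Ideal.span {(p : ℤ_[p]) ^ m}) ↔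
      (p : ℤ) ^ m ∣ z := by
    intro m z
    rw [← PadicInt.norm_le_pow_iff_mem_span_pow, PadicInt.norm_int_le_pow_iff_dvd]
  have hprime : (Ideal.span {(p : ℤ_[p])}).IsPrime :=
    (Ideal.span_singleton_prime (PadicInt.prime_p.ne_zero)).2 PadicInt.prime_p
  have hgE : (f.map φ).IsEisensteinAt (Ideal.span {(p : ℤ_[p])}) := by
    refine hgm.isEisensteinAt_of_mem_of_notMem hprime.ne_top (fun {i} hi => ?_) ?_
    · rw [hdeg] at hi
      have h1 := hE.mem hi
      rw [coeff_map]
      have := (key 1 (f.coeff i)).2 (by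
        simpa [Ideal.submodule_span_eq, Ideal.mem_span_singleton] using h1)
      simpa using this
    · have h1 := hE.notMem
      rw [coeff_map, Ideal.span_singleton_pow]
      intro h2
      apply h1
      have h3 := (key 2 (f.coeff 0)).1 h2
      simpa [Ideal.submodule_span_eq, Ideal.span_singleton_pow, Ideal.mem_span_singleton] using h3
  have hcomp : f.map φ = (cyclotomic (p ^ (n + 1)) ℤ_[p]).comp (X + 1) := by
    simp [hf, map_comp]
  have hirr : Irreducible (f.map φ) := by
    refine hgE.irreducible hprime hgm.isPrimitive ?_
    rw [hcomp, natDegree_comp, natDegree_cyclotomic]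
    have : (X + 1 : ℤ_[p][X]).natDegree = 1 := natDegree_X_add_C (1 : ℤ_[p])
    rw [this, mul_one]
    exact Nat.totient_pos.2 (pow_pos hp.pos _)
  have hirr2 : Irreducible (cyclotomic (p ^ (n + 1)) ℤ_[p]) := by
    rw [hcomp] at hirr
    refine (MulEquiv.irreducible_iff (Polynomial.algEquivAevalXAddC (1 : ℤ_[p]))).1 ?_
    simpa [comp_eq_aeval] using hirr
  have h3 := ((cyclotomic.monic (p ^ (n + 1)) ℤ_[p]).irreducible_iff_irreducible_map_fraction_map
    (K := ℚ_[p])).1 hirr2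
  simpa using h3

theorem K_isCyclotomicExtension (p : ℕ) [Fact p.Prime] (n : ℕ) :
    IsCyclotomicExtension {p ^ (n + 1)} ℚ_[p] (K p n) := by
  have hp : p.Prime := Fact.out
  have h0 : p ^ (n + 1) ≠ 0 := pow_ne_zero _ hp.ne_zero
  have : NeZero ((p ^ (n + 1) : ℕ) : AlgebraicClosure ℚ_[p]) := ⟨by exact_mod_cast h0⟩
  have := IntermediateField.isCyclotomicExtension_adjoin_of_exists_isPrimitiveRoot {p ^ (n + 1)}
    ℚ_[p] (AlgebraicClosure ℚ_[p]) (by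
      rintro m rfl -
      exact HasEnoughRootsOfUnity.exists_primitiveRoot _ _)
  have hS : {b : AlgebraicClosure ℚ_[p] | ∃ m ∈ ({p ^ (n + 1)} : Set ℕ), m ≠ 0 ∧ b ^ m = 1} =
      {z | z ^ p ^ (n + 1) = 1} := by
    ext b
    simp [hp.ne_zero]
  rw [hS] at this
  exact this

theorem exists_sigma (p : ℕ) [Fact p.Prime] (n : ℕ) (u : ℤ_[p]ˣ) :
    ∃ g : K p n ≃ₐ[ℚ_[p]] K p n,
      ∀ z : K p n, z ^ p ^ (n + 1) = 1 → g z = powPadic (n + 1) z (u : ℤ_[p]) := by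
  have hp : p.Prime := Fact.out
  have : NeZero (p ^ (n + 1)) := ⟨pow_ne_zero _ hp.ne_zero⟩
  have := K_isCyclotomicExtension p n
  let e := IsCyclotomicExtension.autEquivPow (K p n) (cyclotomic_irreducible p n)
  let t : (ZMod (p ^ (n + 1)))ˣ := Units.map (PadicInt.toZModPow (n + 1)).toMonoidHom u
  refine ⟨e.symm t, fun z hz => ?_⟩
  have hζ := IsCyclotomicExtension.zeta_spec (p ^ (n + 1)) ℚ_[p] (K p n)
  obtain ⟨i, -, rfl⟩ := hζ.eq_pow_of_pow_eq_one hz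
  have h1 : hζ.autToPow ℚ_[p] (e.symm t) = t := e.apply_symm_apply t
  have h2 := hζ.autToPow_spec ℚ_[p] (e.symm t)
  rw [h1] at h2
  rw [map_pow, ← h2, powPadic, ← pow_mul, ← pow_mul, mul_comm]
  rfl

/-- `σ_n(u) ∈ Gal(K_n/ℚ_p)`, the automorphism acting by `ζ ↦ ζ^u` on `μ_{p^{n+1}}`. -/
def sigma (p : ℕ) [Fact p.Prime] (n : ℕ) (u : ℤ_[p]ˣ) : K p n ≃ₐ[ℚ_[p]] K p n :=
  (exists_sigma p n u).choose

theorem sigma_spec (p : ℕ) [Fact p.Prime] (n : ℕ) (u : ℤ_[p]ˣ) (z : K p n)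
    (hz : z ^ p ^ (n + 1) = 1) : sigma p n u z = powPadic (n + 1) z (u : ℤ_[p]) :=
  (exists_sigma p n u).choose_spec z hz

theorem sigma_fixes (p : ℕ) [Fact p.Prime] (n : ℕ) (u : ℤ_[p]ˣ)
    (hu : (p : ℤ_[p]) ∣ (u : ℤ_[p]) - 1) (x : AlgebraicClosure ℚ_[p]) (hx : x ∈ K p 0) :
    sigma p n u ⟨x, K_zero_le p n hx⟩ = ⟨x, K_zero_le p n hx⟩ := by
  have hp : p.Prime := Fact.out
  let F : IntermediateField ℚ_[p] (K p n) :=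
    IntermediateField.fixedField (Subgroup.zpowers (sigma p n u))
  suffices h : K p 0 ≤ IntermediateField.lift F by
    have h1 := (IntermediateField.mem_lift (⟨x, K_zero_le p n hx⟩ : K p n)).1 (h hx)
    exact h1 ⟨_, Subgroup.mem_zpowers _⟩
  refine IntermediateField.adjoin_le_iff.2 fun z hz => ?_
  have hz1 : z ^ p = 1 := by simpa using hz
  have hzK : z ∈ K p n := K_zero_le p n (IntermediateField.subset_adjoin _ _ hz)
  refine (IntermediateField.mem_lift (⟨z, hzK⟩ : K p n)).2 ?_
  have hfix : sigma p n u ⟨z, hzK⟩ = ⟨z, hzK⟩ := by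
    have hpow : (⟨z, hzK⟩ : K p n) ^ p = 1 := Subtype.ext hz1
    rw [sigma_spec p n u _ (by rw [pow_succ', pow_mul, hpow, one_pow]), powPadic]
    set v := PadicInt.toZModPow (n + 1) (u : ℤ_[p]) with hv
    have hmod : v.val ≡ 1 [MOD p] := by
      have h1 : PadicInt.toZModPow 1 (u : ℤ_[p]) = 1 := by
        rw [← sub_eq_zero, ← map_one (PadicInt.toZModPow 1 : ℤ_[p] →+* ZMod (p ^ 1)), ← map_sub,
          ← RingHom.mem_ker, PadicInt.ker_toZModPow, pow_one, Ideal.mem_span_singleton]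
        exact hu
      have h2 := PadicInt.cast_toZModPow 1 (n + 1) (by omega) (u : ℤ_[p])
      rw [h1, ← hv, ← ZMod.natCast_val] at h2
      have h3 : ((v.val : ℕ) : ZMod (p ^ 1)) = ((1 : ℕ) : ZMod (p ^ 1)) := by simpa using h2
      simpa using (ZMod.natCast_eq_natCast_iff _ _ _).1 h3
    have h5 : v.val % p = 1 := Eq.trans hmod (Nat.mod_eq_of_lt hp.one_lt)
    rw [pow_eq_pow_mod v.val hpow, h5, pow_one]
  rintro ⟨g, hg⟩
  have : Subgroup.zpowers (sigma p n u) ≤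
      MulAction.stabilizer (K p n ≃ₐ[ℚ_[p]] K p n) (⟨z, hzK⟩ : K p n) := by
    rw [Subgroup.zpowers_le]
    exact hfix
  exact this hg

/-- For `u ≡ 1 mod p`, the element of `Γ_n = Gal(K_n/K_0)` acting by `ζ ↦ ζ^u` on
`μ_{p^{n+1}}`: it is `σ_n(u)`, which fixes `K_0`. -/
def sigmaPrincipal (p : ℕ) [Fact p.Prime] (n : ℕ) (u : ℤ_[p]ˣ)
    (hu : (p : ℤ_[p]) ∣ (u : ℤ_[p]) - 1) : Gam p n :=
  AlgEquiv.ofRingEquiv (f := (sigma p n u).toRingEquiv)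
    fun x => sigma_fixes p n u hu x.1 x.2

theorem sigmaPrincipal_spec (p : ℕ) [Fact p.Prime] (n : ℕ) (u : ℤ_[p]ˣ)
    (hu : (p : ℤ_[p]) ∣ (u : ℤ_[p]) - 1) (z : KOver p n) (hz : z ^ p ^ (n + 1) = 1) :
    sigmaPrincipal p n u hu z = powPadic (n + 1) z (u : ℤ_[p]) :=
  sigma_spec p n u z hz

/-! ### The Teichmüller character -/

theorem exists_teichmuller (p : ℕ) [Fact p.Prime] (u : ℤ_[p]ˣ) :
    ∃ w : ℤ_[p]ˣ, w ^ (p - 1) = 1 ∧ (p : ℤ_[p]) ∣ (u : ℤ_[p]) - w := by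
  have hp : p.Prime := Fact.out
  have hp1 : p - 1 ≠ 0 := by have := hp.two_le; omega
  have hdvd : ∀ x : ℤ_[p], ‖x‖ < 1 ↔ (p : ℤ_[p]) ∣ x := fun x => PadicInt.norm_lt_one_iff_dvd x
  have hnat : ‖((p - 1 : ℕ) : ℤ_[p])‖ = 1 := by
    rw [PadicInt.norm_natCast_eq_one_iff]
    exact (Nat.coprime_self_sub_right hp.one_le).2 (Nat.coprime_one_right p)
  have hu : ‖(u : ℤ_[p])‖ = 1 := PadicInt.norm_units u
  let F : ℤ_[p][X] := X ^ (p - 1) - 1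
  have hd : ‖F.derivative.aeval (u : ℤ_[p])‖ = 1 := by
    have h1 : F.derivative.aeval (u : ℤ_[p]) =
        ((p - 1 : ℕ) : ℤ_[p]) * (u : ℤ_[p]) ^ (p - 1 - 1) := by
      simp only [F, derivative_sub, derivative_X_pow, derivative_one, sub_zero, coe_aeval_eq_eval,
        eval_mul, eval_pow, eval_X, eval_C]
    rw [h1, norm_mul, norm_pow, hu, hnat, one_pow, mul_one]
  have hF : ‖F.aeval (u : ℤ_[p])‖ < 1 := by
    have h1 : F.aeval (u : ℤ_[p]) = (u : ℤ_[p]) ^ (p - 1) - 1 := by simp [F]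
    rw [h1, hdvd, ← Ideal.mem_span_singleton, ← PadicInt.maximalIdeal_eq_span_p,
      ← PadicInt.ker_toZMod, RingHom.mem_ker, map_sub, map_pow, map_one, sub_eq_zero]
    exact ZMod.pow_card_sub_one_eq_one ((u.isUnit.map PadicInt.toZMod).ne_zero)
  obtain ⟨z, hz, hzu, -, -⟩ := hensels_lemma (F := F) (a := (u : ℤ_[p])) (by rw [hd]; simpa using hF)
  have hz1 : z ^ (p - 1) = 1 := by simpa [F, sub_eq_zero] using hz
  refine ⟨Units.ofPowEqOne z (p - 1) hz1 hp1, Units.pow_ofPowEqOne hz1 hp1, ?_⟩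
  rw [hd, hdvd] at hzu
  rw [← dvd_neg, neg_sub]
  exact hzu

/-- The Teichmüller representative `ω(u)`: the `(p-1)`-th root of unity congruent to `u`
modulo `p`. -/
def teich (p : ℕ) [Fact p.Prime] (u : ℤ_[p]ˣ) : ℤ_[p]ˣ := (exists_teichmuller p u).choose

/-- `⟨u⟩`, defined by `u = ω(u)⟨u⟩`. -/
def angle (p : ℕ) [Fact p.Prime] (u : ℤ_[p]ˣ) : ℤ_[p]ˣ := (teich p u)⁻¹ * u

theorem angle_congr_one (p : ℕ) [Fact p.Prime] (u : ℤ_[p]ˣ) :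
    (p : ℤ_[p]) ∣ (angle p u : ℤ_[p]) - 1 := by
  have h := (exists_teichmuller p u).choose_spec.2
  have h2 : (angle p u : ℤ_[p]) - 1 =
      ((teich p u)⁻¹ : ℤ_[p]ˣ) * ((u : ℤ_[p]) - teich p u) := by
    simp [angle, mul_sub]
  rw [h2]
  exact h.mul_left _

/-- `γ_n(u) ∈ Γ_n`, acting by `ζ ↦ ζ^⟨u⟩` on `μ_{p^{n+1}}`. -/
def gamma (p : ℕ) [Fact p.Prime] (n : ℕ) (u : ℤ_[p]ˣ) : Gam p n :=
  sigmaPrincipal p n (angle p u) (angle_congr_one p u)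

theorem isUnit_one_add_p (p : ℕ) [Fact p.Prime] : IsUnit (1 + p : ℤ_[p]) := by
  have : ((1 + p : ℕ) : ℤ_[p]) = 1 + p := by push_cast; ring
  rw [← this, PadicInt.isUnit_iff, PadicInt.norm_natCast_eq_one_iff]
  simp

/-- The image in `Γ_n` of the topological generator `γ_0` of `Gal(K_∞/K_0)` that acts by
`ζ ↦ ζ^{1+p}`. -/
def gammaZero (p : ℕ) [Fact p.Prime] (n : ℕ) : Gam p n :=
  sigmaPrincipal p n (isUnit_one_add_p p).unit (by simp)

/-! ### The elements `M_n(θ, a)` and the power series `M(T, θ, a)` -/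

theorem isUnit_natCast (p : ℕ) [Fact p.Prime] (k : ℕ) (hk : ¬ p ∣ k) :
    IsUnit (k : ℤ_[p]) :=
  PadicInt.isUnit_iff.2 (PadicInt.norm_natCast_eq_one_iff.2 ((Nat.Prime.coprime_iff_not_dvd Fact.out).2 hk))

/-- A natural number prime to `p`, as a unit of `ℤ_p`. -/
def natUnit (p : ℕ) [Fact p.Prime] (k : ℕ) (hk : ¬ p ∣ k) : ℤ_[p]ˣ :=
  (isUnit_natCast p k hk).unit

/-- The characters of `Δ` with values in `μ_{p-1} ⊆ ℤ_p`. -/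
abbrev DeltaChar (p : ℕ) [Fact p.Prime] : Type := Delta p →* rootsOfUnity (p - 1) ℤ_[p]

/-- `θ(u) ∈ ℤ_pˣ` for a unit `u` of `ℤ_p`: the value of `θ` at the element of `Δ` which acts by
`ζ ↦ ζ^u` on `μ_p`. -/
def charVal {p : ℕ} [Fact p.Prime] (θ : DeltaChar p) (u : ℤ_[p]ˣ) : ℤ_[p]ˣ :=
  (θ (sigma p 0 u) : ℤ_[p]ˣ)

/-- `θ` is odd if `θ(-1) = -1`. -/
def IsOdd {p : ℕ} [Fact p.Prime] (θ : DeltaChar p) : Prop := charVal θ (-1) = -1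

/-- The valuation ring `O_L` of a finite extension `L` of `ℚ_p`, i.e. the integral closure of
`ℤ_p` in `L`. -/
abbrev OL (p : ℕ) [Fact p.Prime] (L : Type*) [Field L] [Algebra ℤ_[p] L] : Type _ :=
  integralClosure ℤ_[p] L

/-- `M_n(θ, a) = ∑ a^k / (a^{p^{n+1}} - 1) θ(k) ω⁻¹(k) γ_n(k) ∈ O_L[Γ_n]`, the sum being over the
integers `1 ≤ k ≤ p^{n+1} - 1` prime to `p`. -/
def mirimanoffElement {p : ℕ} [Fact p.Prime] {L : Type*} [Field L] [Algebra ℤ_[p] L]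
    (θ : DeltaChar p) (a : OL p L) (n : ℕ) : MonoidAlgebra (OL p L) (Gam p n) :=
  ∑ k ∈ Finset.Icc 1 (p ^ (n + 1) - 1),
    if hk : p ∣ k then 0 else
      MonoidAlgebra.single (gamma p n (natUnit p k hk))
        (a ^ k * Ring.inverse (a ^ p ^ (n + 1) - 1) *
          algebraMap ℤ_[p] (OL p L)
            ((charVal θ (natUnit p k hk) * (teich p (natUnit p k hk))⁻¹ : ℤ_[p]ˣ) : ℤ_[p]))

/-- The power series `f ∈ O_L[[T]]` corresponds to the system `(x_n)` with `x_n ∈ O_L[Γ_n]`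
under the isomorphism `O_L[[T]] ≃ lim O_L[Γ_n]`, `T ↦ γ_0 - 1`. That isomorphism is obtained from
`O_L[[T]]/(ω_n) ≃ O_L[T]/(ω_n) ≃ O_L[Γ_n]`, where `ω_n = (1+T)^{p^n} - 1`: thus `f` must be
congruent modulo `ω_n` to a polynomial whose value at `T = γ_0 - 1` is `x_n`. -/
def Corresponds {p : ℕ} [Fact p.Prime] {R : Type*} [CommRing R] (f : PowerSeries R)
    (x : ∀ n, MonoidAlgebra R (Gam p n)) : Prop :=
  ∀ n, ∃ P : R[X],
    ((1 + PowerSeries.X) ^ p ^ n - 1 : PowerSeries R) ∣ f - (P : PowerSeries R) ∧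
    Polynomial.aeval (MonoidAlgebra.single (gammaZero p n) (1 : R) - 1 :
      MonoidAlgebra R (Gam p n)) P = x n

/-- `M` is the Mirimanoff power series `M(T, θ, a)`. -/
def IsMirimanoffSeries {p : ℕ} [Fact p.Prime] {L : Type*} [Field L] [Algebra ℤ_[p] L]
    (θ : DeltaChar p) (a : OL p L) (M : PowerSeries (OL p L)) : Prop :=
  Corresponds M (mirimanoffElement θ a)

end Mirimanoff

end

/-!
Write `R = O_L`, `k = R / π`, `ω_n = (1 + T)^{p^n} - 1`, and let `e_n(m)` be the exponent modulo
`p^n` with `γ_n(m) = γ_0^{e_n(m)}`. The element `M_n(θ, a)` is the value at `T = γ_0 - 1` of the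
polynomial `∑ a^m / (a^{p^{n+1}} - 1) θ(m) ω(m)⁻¹ (1 + T)^{e_n(m)}` (`mirimanoffPoly`). These
polynomials are compatible modulo `ω_n` by summation of a geometric series
(`omegaPoly_dvd_mirimanoffPoly_sub`). The series `M` exists because `R` is compact
(`exists_forall_omega_dvd_sub`), and is unique because `γ_0` has order exactly `p^n` in `Γ_n`
(`omegaPoly_dvd_of_aeval_eq_zero`) and `⋂ (ω_n) = 0` (`eq_zero_of_forall_omega_dvd`).

Modulo `π` one has `ω_n = T^{p^n}`, whose derivative vanishes, and `(1 + T) d/dT` multiplies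
`(1 + T)^i` by `i`. Hence `M' ≡ 0` if and only if the coefficient of `γ_0^i` in `M_n(θ, a)` is
divisible by `π` whenever `p ∤ i` (`derivative_eq_zero_iff`). Up to a unit this coefficient is
`∑ θ(η) η⁻¹ a^{[η z]}` over `η ∈ μ_{p-1}`, where `z = (1 + p)^i` and `[x]` is the least
non-negative residue of `x` modulo `p^{n+1}` (`C_dvd_derivative_iff`).

If `a ≡ -1` and `θ` is odd, then the terms of `η` and `-η` cancel, as `[-x] = p^{n+1} - [x]`
(`sum_eq_zero_of_even`). The converse follows Sinnott's approach to the vanishing of the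
`μ`-invariant. Suppose that the sums vanish for all `z ≡ 1 + p mod p^2`. The measure
`z ↦ a^{[η z]}` on `1 + p + p^2 ℤ_p` is the expression
`a^j [η⁻¹ j] / (1 - a^{p^2} [η⁻¹ p^2])` in group elements `[x]`, `x ∈ ℤ_p`, with a fixed `j`
depending on `η`. Clearing denominators turns the relation into an identity in the group algebra
`k[ℤ_p]` (no completion). Specialize it by `[x] ↦ χ(x) [x mod ℚ] ∈ k̄[ℚ_p / ℚ]`, a domain, where
`χ : ℤ_p → k̄ˣ` is a homomorphism with `χ(1) = a⁻¹` (`exists_specialization`): the denominator of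
`η = 1` becomes zero, and those of `η ≠ ±1` do not, because such an `η` is irrational. So the
coefficient of `η = 1` can only be non-zero if the denominator of `η = -1` vanishes too, i.e. if
`a^2 ≡ 1` (`coeff_one_eq_zero`). In that case `a ≡ -1`, the measures of `1` and `-1` are
opposite, and the same argument after merging these two terms gives `θ(-1) = -1`
(`eq_neg_one_of_sum_eq_zero`).
-/


noncomputable section

namespace Mirimanoff

/-! ### Galois automorphisms and their action on roots of unity -/

section Galois

variable {p : ℕ} [Fact p.Prime]

theorem toZModPow_eq_iff_dvd (m : ℕ) (u v : ℤ_[p]) :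
    PadicInt.toZModPow m u = PadicInt.toZModPow m v ↔ (p : ℤ_[p]) ^ m ∣ u - v := by
  rw [← sub_eq_zero, ← map_sub, ← RingHom.mem_ker, PadicInt.ker_toZModPow,
    Ideal.mem_span_singleton]

theorem algEquiv_ext {n : ℕ} {g h : K p n ≃ₐ[ℚ_[p]] K p n}
    (H : ∀ z : K p n, z ^ p ^ (n + 1) = 1 → g z = h z) : g = h := by
  have : (g : K p n →ₐ[ℚ_[p]] K p n) = h := by
    refine IntermediateField.algHom_ext_of_eq_adjoin ℚ_[p] (S := K p n) rfl fun x hx => ?_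
    exact H _ (Subtype.ext hx)
  exact AlgEquiv.ext fun x => DFunLike.congr_fun this x

section powPadic

variable {F : Type} [Monoid F] {m : ℕ} {z : F}

theorem powPadic_congr (m : ℕ) (z : F) {u v : ℤ_[p]} (h : (p : ℤ_[p]) ^ m ∣ u - v) :
    powPadic m z u = powPadic m z v := by
  rw [powPadic, powPadic, (toZModPow_eq_iff_dvd m u v).2 h]

theorem powPadic_pow_eq_one (hz : z ^ p ^ m = 1) (u : ℤ_[p]) : powPadic m z u ^ p ^ m = 1 := by
  rw [powPadic, ← pow_mul, mul_comm, pow_mul, hz, one_pow]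

theorem powPadic_powPadic (hz : z ^ p ^ m = 1) (u v : ℤ_[p]) :
    powPadic m (powPadic m z u) v = powPadic m z (u * v) := by
  rw [powPadic, powPadic, powPadic, ← pow_mul, map_mul, ZMod.val_mul, ← pow_eq_pow_mod _ hz]

end powPadic

theorem sigma_mul (n : ℕ) (u v : ℤ_[p]ˣ) : sigma p n (u * v) = sigma p n u * sigma p n v := by
  refine algEquiv_ext fun z hz => ?_
  rw [AlgEquiv.mul_apply, sigma_spec p n v z hz,
    sigma_spec p n u _ (powPadic_pow_eq_one hz _), powPadic_powPadic hz, sigma_spec p n _ z hz,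
    Units.val_mul, mul_comm]

theorem sigma_congr (n : ℕ) {u v : ℤ_[p]ˣ} (h : (p : ℤ_[p]) ^ (n + 1) ∣ (u : ℤ_[p]) - v) :
    sigma p n u = sigma p n v := by
  refine algEquiv_ext fun z hz => ?_
  rw [sigma_spec p n u z hz, sigma_spec p n v z hz, powPadic_congr _ _ h]

theorem sigma_eq_sigma_iff (n : ℕ) (u v : ℤ_[p]ˣ) :
    sigma p n u = sigma p n v ↔ (p : ℤ_[p]) ^ (n + 1) ∣ (u : ℤ_[p]) - v := by
  refine ⟨fun h => ?_, sigma_congr n⟩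
  have hp : p.Prime := Fact.out
  have : NeZero (p ^ (n + 1)) := ⟨pow_ne_zero _ hp.ne_zero⟩
  have := K_isCyclotomicExtension p n
  have hζ := IsCyclotomicExtension.zeta_spec (p ^ (n + 1)) ℚ_[p] (K p n)
  have h1 := sigma_spec p n u _ hζ.pow_eq_one
  rw [h, sigma_spec p n v _ hζ.pow_eq_one] at h1
  have h2 := hζ.pow_inj (ZMod.val_lt _) (ZMod.val_lt _) h1
  exact (toZModPow_eq_iff_dvd _ _ _).1 (ZMod.val_injective _ h2).symm

theorem sigmaPrincipal_eq_iff (n : ℕ) {u v : ℤ_[p]ˣ} (hu : (p : ℤ_[p]) ∣ (u : ℤ_[p]) - 1)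
    (hv : (p : ℤ_[p]) ∣ (v : ℤ_[p]) - 1) :
    sigmaPrincipal p n u hu = sigmaPrincipal p n v hv ↔
      (p : ℤ_[p]) ^ (n + 1) ∣ (u : ℤ_[p]) - v := by
  rw [← sigma_eq_sigma_iff]
  exact ⟨fun h => AlgEquiv.ext fun x => DFunLike.congr_fun h x,
    fun h => AlgEquiv.ext fun x => DFunLike.congr_fun h x⟩

theorem sigmaPrincipal_mul (n : ℕ) {u v : ℤ_[p]ˣ} (hu : (p : ℤ_[p]) ∣ (u : ℤ_[p]) - 1)
    (hv : (p : ℤ_[p]) ∣ (v : ℤ_[p]) - 1) (huv : (p : ℤ_[p]) ∣ ((u * v : ℤ_[p]ˣ) : ℤ_[p]) - 1) :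
    sigmaPrincipal p n (u * v) huv = sigmaPrincipal p n u hu * sigmaPrincipal p n v hv :=
  AlgEquiv.ext fun x => DFunLike.congr_fun (sigma_mul n u v) x

theorem one_add_p_pow_congr_one (i : ℕ) :
    (p : ℤ_[p]) ∣ (((isUnit_one_add_p p).unit ^ i : ℤ_[p]ˣ) : ℤ_[p]) - 1 := by
  have := sub_dvd_pow_sub_pow (1 + p : ℤ_[p]) 1 i
  simpa using this

theorem gammaZero_pow (n i : ℕ) :
    gammaZero p n ^ i =
      sigmaPrincipal p n ((isUnit_one_add_p p).unit ^ i) (one_add_p_pow_congr_one i) := by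
  induction i with
  | zero =>
    have h := sigmaPrincipal_mul n (u := 1) (v := 1) (p := p) (by simp) (by simp) (by simp)
    simp only [mul_one] at h
    simp only [pow_zero]
    exact (mul_eq_left.1 h.symm).symm
  | succ i ih =>
    have h1 := one_add_p_pow_congr_one (p := p) (i + 1)
    rw [pow_succ, ih]
    simp only [pow_succ _ i] at h1 ⊢
    exact (sigmaPrincipal_mul n (one_add_p_pow_congr_one i) (by simp) h1).symm

theorem gammaZero_pow_eq_iff (n i j : ℕ) :
    gammaZero p n ^ i = gammaZero p n ^ j ↔
      (1 + p : ZMod (p ^ (n + 1))) ^ i = (1 + p : ZMod (p ^ (n + 1))) ^ j := by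
  rw [gammaZero_pow, gammaZero_pow, sigmaPrincipal_eq_iff, ← toZModPow_eq_iff_dvd]
  simp

theorem gamma_eq_gammaZero_pow_iff (n i : ℕ) (u : ℤ_[p]ˣ) :
    gamma p n u = gammaZero p n ^ i ↔
      PadicInt.toZModPow (n + 1) (angle p u : ℤ_[p]) = (1 + p : ZMod (p ^ (n + 1))) ^ i := by
  rw [gammaZero_pow, gamma, sigmaPrincipal_eq_iff, ← toZModPow_eq_iff_dvd]
  simp

theorem gammaZero_pow_eq_iff_modEq (hp2 : p ≠ 2) (n i j : ℕ) :
    gammaZero p n ^ i = gammaZero p n ^ j ↔ i ≡ j [MOD p ^ n] := by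
  have hp : p.Prime := Fact.out
  rw [gammaZero_pow_eq_iff]
  have hu : IsUnit (1 + p : ZMod (p ^ (n + 1))) := by
    have := (isUnit_one_add_p p).map (PadicInt.toZModPow (n + 1))
    simpa using this
  obtain ⟨g, hg⟩ := hu
  rw [← ZMod.orderOf_one_add_prime hp hp2 n, ← hg, orderOf_units, ← pow_eq_pow_iff_modEq,
    ← Units.val_pow_eq_pow_val, ← Units.val_pow_eq_pow_val, Units.val_inj]

theorem exists_pow_eq_of_congr_one (hp2 : p ≠ 2) (n : ℕ) (u : ℤ_[p])
    (hu : (p : ℤ_[p]) ∣ u - 1) :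
    ∃ i < p ^ n, PadicInt.toZModPow (n + 1) u = (1 + p : ZMod (p ^ (n + 1))) ^ i := by
  classical
  have hp : p.Prime := Fact.out
  have : NeZero (p ^ (n + 1)) := ⟨pow_ne_zero _ hp.ne_zero⟩
  have hg1 : IsUnit (1 + p : ZMod (p ^ (n + 1))) := by
    have := (isUnit_one_add_p p).map (PadicInt.toZModPow (n + 1))
    simpa using this
  obtain ⟨g, hg⟩ := hg1
  have hord : orderOf g = p ^ n := by
    rw [← orderOf_units, hg, ZMod.orderOf_one_add_prime hp hp2 n]
  have hu1 : IsUnit u := by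
    by_contra h
    have h1 : (p : ℤ_[p]) ∣ u := by
      rw [← Ideal.mem_span_singleton, ← PadicInt.maximalIdeal_eq_span_p]
      exact h
    exact PadicInt.prime_p.not_isUnit (isUnit_of_dvd_one ((dvd_sub_right h1).1 hu))
  obtain ⟨x, hx⟩ := hu1.map (PadicInt.toZModPow (n + 1))
  have hcyc : IsCyclic (ZMod (p ^ (n + 1)))ˣ := ZMod.isCyclic_units_of_prime_pow p hp hp2 _
  have hxp : x ^ p ^ n = 1 := by
    apply Units.ext
    have h1 := dvd_sub_pow_of_dvd_sub (R := ℤ_[p]) (p := p) (a := u) (b := 1) (by simpa using hu) n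
    rw [Units.val_pow_eq_pow_val, hx, ← map_pow, Units.val_one,
      ← map_one (PadicInt.toZModPow (n + 1) : ℤ_[p] →+* ZMod (p ^ (n + 1))), toZModPow_eq_iff_dvd]
    simpa using h1
  have hcard := IsCyclic.card_pow_eq_one_le (α := (ZMod (p ^ (n + 1)))ˣ) (n := p ^ n)
    (pow_pos hp.pos n)
  have hsub : (Finset.range (p ^ n)).image (fun i => g ^ i) ⊆
      Finset.univ.filter fun y : (ZMod (p ^ (n + 1)))ˣ => y ^ p ^ n = 1 := by
    intro y hy
    obtain ⟨i, -, rfl⟩ := Finset.mem_image.1 hy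
    simp only [Finset.mem_filter, Finset.mem_univ, true_and]
    rw [← pow_mul, mul_comm, pow_mul, ← hord, pow_orderOf_eq_one, one_pow]
  have heq := Finset.eq_of_subset_of_card_le hsub (by
    refine hcard.trans ?_
    rw [Finset.card_image_of_injOn, Finset.card_range]
    intro i hi j hj hij
    rw [Finset.coe_range, Set.mem_Iio, ← hord] at hi hj
    exact pow_injOn_Iio_orderOf hi hj hij)
  have hmem : x ∈ (Finset.range (p ^ n)).image (fun i => g ^ i) := by
    rw [heq]; simpa using hxp
  obtain ⟨i, hi, hix⟩ := Finset.mem_image.1 hmem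
  refine ⟨i, Finset.mem_range.1 hi, ?_⟩
  rw [← hx, ← hix, Units.val_pow_eq_pow_val, hg]

end Galois

/-! ### Teichmüller representatives and characters -/

section Teichmuller

variable {p : ℕ} [Fact p.Prime]

theorem charVal_mul (θ : DeltaChar p) (u v : ℤ_[p]ˣ) :
    charVal θ (u * v) = charVal θ u * charVal θ v := by
  rw [charVal, sigma_mul, map_mul]; rfl

theorem charVal_congr (θ : DeltaChar p) {u v : ℤ_[p]ˣ} (h : (p : ℤ_[p]) ∣ (u : ℤ_[p]) - v) :
    charVal θ u = charVal θ v := by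
  rw [charVal, sigma_congr 0 (by simpa using h)]; rfl

theorem charVal_one (θ : DeltaChar p) : charVal θ 1 = 1 := by
  have := charVal_mul θ 1 1
  rw [mul_one] at this
  exact (left_eq_mul.1 this)

theorem teich_pow (u : ℤ_[p]ˣ) : teich p u ^ (p - 1) = 1 :=
  (exists_teichmuller p u).choose_spec.1

theorem teich_congr (u : ℤ_[p]ˣ) : (p : ℤ_[p]) ∣ (u : ℤ_[p]) - teich p u :=
  (exists_teichmuller p u).choose_spec.2

theorem charVal_teich (θ : DeltaChar p) (u : ℤ_[p]ˣ) : charVal θ (teich p u) = charVal θ u :=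
  (charVal_congr θ (teich_congr u)).symm

/-- Distinct `(p-1)`-th roots of unity in `ℤ_p` are incongruent modulo `p`. -/
theorem eq_of_pow_eq_one_of_congr {v w : ℤ_[p]ˣ} (hv : v ^ (p - 1) = 1) (hw : w ^ (p - 1) = 1)
    (h : (p : ℤ_[p]) ∣ (v : ℤ_[p]) - w) : v = w := by
  have hp : p.Prime := Fact.out
  -- `t = v / w` is a root of unity `≡ 1 mod p`, hence `0 = t ^ (p - 1) - 1 = (t - 1) * s`
  -- with `s = ∑ t ^ i ≡ p - 1 mod p` a unit.
  set t : ℤ_[p] := ((v * w⁻¹ : ℤ_[p]ˣ) : ℤ_[p]) with ht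
  have ht1 : t ^ (p - 1) = 1 := by
    rw [ht, ← Units.val_pow_eq_pow_val, mul_pow, inv_pow, hv, hw]; simp
  have htp : (p : ℤ_[p]) ∣ t - 1 := by
    have : t - 1 = ((v : ℤ_[p]) - w) * ((w⁻¹ : ℤ_[p]ˣ) : ℤ_[p]) := by
      rw [sub_mul, Units.mul_inv, ht, Units.val_mul]
    rw [this]
    exact h.mul_right _
  have hs : (p : ℤ_[p]) ∣ (∑ i ∈ Finset.range (p - 1), t ^ i) - ((p - 1 : ℕ) : ℤ_[p]) := by
    have : (∑ i ∈ Finset.range (p - 1), t ^ i) - ((p - 1 : ℕ) : ℤ_[p]) =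
        ∑ i ∈ Finset.range (p - 1), (t ^ i - 1 ^ i) := by simp
    rw [this]
    exact Finset.dvd_sum fun i _ => htp.trans (sub_dvd_pow_sub_pow t 1 i)
  have hs0 : (∑ i ∈ Finset.range (p - 1), t ^ i) ≠ 0 := by
    intro h0
    rw [h0, zero_sub, dvd_neg, Nat.cast_sub hp.one_le, dvd_sub_right (dvd_refl _)] at hs
    exact PadicInt.prime_p.not_dvd_one (by simpa using hs)
  have hmul := geom_sum_mul t (p - 1)
  rw [ht1, sub_self, mul_eq_zero, or_iff_right hs0, sub_eq_zero] at hmul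
  have : v * w⁻¹ = 1 := Units.ext hmul
  exact mul_inv_eq_one.1 this

theorem teich_eq_of_congr {u w : ℤ_[p]ˣ} (hw : w ^ (p - 1) = 1)
    (h : (p : ℤ_[p]) ∣ (u : ℤ_[p]) - w) : teich p u = w :=
  eq_of_pow_eq_one_of_congr (teich_pow u) hw (by
    have := dvd_sub h (teich_congr u)
    simpa using this)

theorem teich_congr_of_congr {u v : ℤ_[p]ˣ} (h : (p : ℤ_[p]) ∣ (u : ℤ_[p]) - v) :
    teich p u = teich p v :=
  teich_eq_of_congr (teich_pow v) (by simpa using dvd_add h (teich_congr v))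

theorem teich_mul_angle (u : ℤ_[p]ˣ) : teich p u * angle p u = u := by
  rw [angle, mul_inv_cancel_left]

theorem angle_sub_angle_dvd {m : ℕ} (hm : m ≠ 0) {u v : ℤ_[p]ˣ}
    (h : (p : ℤ_[p]) ^ m ∣ (u : ℤ_[p]) - v) :
    (p : ℤ_[p]) ^ m ∣ (angle p u : ℤ_[p]) - angle p v := by
  rw [angle, angle, teich_congr_of_congr ((dvd_pow_self _ hm).trans h), Units.val_mul,
    Units.val_mul, ← mul_sub]
  exact h.mul_left _

end Teichmuller

/-! ### Power series modulo `(1 + T)^{p^n} - 1` -/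

section PowerSeriesModOmega

/-- The polynomial `ω_n = (1 + X)^{p^n} - 1`. -/
def omegaPoly (p : ℕ) (R : Type*) [CommRing R] (n : ℕ) : R[X] := (1 + X) ^ p ^ n - 1

theorem coe_omegaPoly (p : ℕ) (R : Type*) [CommRing R] (n : ℕ) :
    (omegaPoly p R n : PowerSeries R) = (1 + PowerSeries.X) ^ p ^ n - 1 := by
  simp [omegaPoly]

theorem omegaPoly_dvd_succ (p : ℕ) (R : Type*) [CommRing R] (n : ℕ) :
    omegaPoly p R n ∣ omegaPoly p R (n + 1) := by
  have := sub_dvd_pow_sub_pow ((1 + X : R[X]) ^ p ^ n) 1 p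
  rwa [one_pow, ← pow_mul, ← pow_succ] at this

theorem omegaPoly_dvd_pow_sub_pow (p : ℕ) (R : Type*) [CommRing R] {n i j : ℕ}
    (h : i ≡ j [MOD p ^ n]) : omegaPoly p R n ∣ (1 + X) ^ i - (1 + X) ^ j := by
  wlog hij : i ≤ j generalizing i j
  · rw [← dvd_neg, neg_sub]
    exact this h.symm (le_of_not_ge hij)
  obtain ⟨d, hd⟩ := (Nat.modEq_iff_dvd' hij).1 h
  have h1 : (1 + X : R[X]) ^ i - (1 + X) ^ j =
      -((1 + X) ^ i * (((1 + X) ^ p ^ n) ^ d - 1 ^ d)) := by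
    rw [← pow_mul, ← hd, one_pow, mul_sub, ← pow_add, Nat.add_sub_cancel' hij]
    ring
  rw [h1, dvd_neg]
  exact (sub_dvd_pow_sub_pow _ _ d).mul_left _

/-- The kernel of `R[X] → R[G]`, `X ↦ g - 1`, for `g` of order `p^n`. -/
theorem omegaPoly_dvd_of_aeval_eq_zero {p : ℕ} (hp : 0 < p) {R G : Type*} [CommRing R] [Group G]
    {n : ℕ} {g : G} (hg : ∀ i j, g ^ i = g ^ j ↔ i ≡ j [MOD p ^ n]) {P : R[X]}
    (hP : aeval (MonoidAlgebra.single g (1 : R) - 1) P = 0) : omegaPoly p R n ∣ P := by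
  have hN : 0 < p ^ n := pow_pos hp n
  set Q : R[X] := P.comp (X - 1) with hQ
  have hPQ : P = Q.comp (1 + X) := by
    rw [hQ, comp_assoc]; simp
  have hQ0 : aeval (MonoidAlgebra.single g (1 : R)) Q = 0 := by
    rw [hQ, aeval_comp]; simpa using hP
  have hgN : g ^ p ^ n = 1 := by
    rw [← pow_zero g, hg]; simp [Nat.ModEq]
  have hmonic : (X ^ p ^ n - 1 : R[X]).Monic := monic_X_pow_sub_C 1 hN.ne'
  set r := Q %ₘ (X ^ p ^ n - 1) with hr
  have hdiv : r + (X ^ p ^ n - 1) * (Q /ₘ (X ^ p ^ n - 1)) = Q := modByMonic_add_div _ _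
  have hr0 : aeval (MonoidAlgebra.single g (1 : R)) r = 0 := by
    rw [← hdiv] at hQ0
    simpa [MonoidAlgebra.single_pow, hgN, ← MonoidAlgebra.one_def] using hQ0
  have hr1 : r = 0 := by
    nontriviality R
    have hdeg : r.natDegree < p ^ n := by
      refine natDegree_modByMonic_lt Q hmonic ?_ |>.trans_eq (natDegree_X_pow_sub_C (r := (1 : R)))
      intro h
      have := congrArg natDegree h
      rw [show (1 : R[X]) = C 1 from rfl, natDegree_X_pow_sub_C, natDegree_C] at this
      exact hN.ne' this
    rw [aeval_eq_sum_range' hdeg] at hr0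
    ext i
    by_cases hi : i < p ^ n
    · have h1 := congrArg (fun x => x.coeff (g ^ i)) hr0
      simp only [MonoidAlgebra.single_pow, one_pow, MonoidAlgebra.smul_single, smul_eq_mul,
        mul_one, MonoidAlgebra.coeff_sum, Finsupp.finsetSum_apply, MonoidAlgebra.coeff_single,
        MonoidAlgebra.coeff_zero, Finsupp.coe_zero, Pi.zero_apply] at h1
      rw [Finset.sum_eq_single i] at h1
      · simpa using h1
      · intro j hj hji
        refine Finsupp.single_eq_of_ne' fun h => hji ?_
        exact Nat.ModEq.eq_of_lt_of_lt ((hg _ _).1 h) (Finset.mem_range.1 hj) hi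
      · exact fun h => (h (Finset.mem_range.2 hi)).elim
    · rw [coeff_eq_zero_of_natDegree_lt (hdeg.trans_le (not_lt.1 hi)), coeff_zero]
  rw [hr1, zero_add] at hdiv
  refine ⟨(Q /ₘ (X ^ p ^ n - 1)).comp (1 + X), ?_⟩
  rw [hPQ]
  conv_lhs => rw [← hdiv]
  simp [omegaPoly]

theorem pow_dvd_factorial_mul_choose {p n d i : ℕ} (hi0 : i ≠ 0) (hid : i ≤ d) :
    p ^ n ∣ d.factorial * (p ^ n).choose i := by
  obtain ⟨m, hm⟩ := Nat.dvd_factorial (Nat.pos_of_ne_zero hi0) hid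
  have h : p ^ n ∣ i * (p ^ n).choose i := by
    obtain ⟨j, rfl⟩ := Nat.exists_eq_succ_of_ne_zero hi0
    rcases Nat.eq_zero_or_pos (p ^ n) with h0 | h0
    · simp [h0]
    · obtain ⟨N, hN⟩ := Nat.exists_eq_succ_of_ne_zero h0.ne'
      rw [hN, mul_comm, Nat.succ_eq_add_one, Nat.succ_eq_add_one, ← Nat.add_one_mul_choose_eq]
      exact dvd_mul_right _ _
  rw [hm, mul_right_comm]
  exact h.mul_right _

/-- The intersection of the ideals `(ω_n)` of `R[[T]]` is zero if `R` is `p`-adically separated. -/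
theorem eq_zero_of_forall_omega_dvd {p : ℕ} {R : Type*} [CommRing R] [IsDomain R] [CharZero R]
    (hsep : ∀ x : R, (∀ n, (p : R) ^ n ∣ x) → x = 0) {f : PowerSeries R}
    (hf : ∀ n, ((1 + PowerSeries.X) ^ p ^ n - 1 : PowerSeries R) ∣ f) : f = 0 := by
  ext d
  suffices h : (d.factorial : R) * PowerSeries.coeff d f = 0 by
    rw [map_zero]
    exact (mul_eq_zero.1 h).resolve_left (by exact_mod_cast d.factorial_ne_zero)
  refine hsep _ fun n => ?_
  obtain ⟨h, rfl⟩ := hf n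
  rw [PowerSeries.coeff_mul, Finset.mul_sum]
  refine Finset.dvd_sum fun ij hij => ?_
  rw [← mul_assoc]
  refine Dvd.dvd.mul_right ?_ _
  rw [← coe_omegaPoly, coeff_coe, omegaPoly, coeff_sub, coeff_one_add_X_pow, coeff_one]
  by_cases h0 : ij.1 = 0
  · simp [h0]
  · have h1 := pow_dvd_factorial_mul_choose (p := p) (n := n) (d := d) h0
      (Finset.HasAntidiagonal.antidiagonal.fst_le hij)
    rw [if_neg h0, sub_zero]
    exact_mod_cast (Nat.cast_dvd_cast (α := R) h1)

open scoped PowerSeries.WithPiTopology in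
/-- Surjectivity of `R[[T]] → lim R[T]/(ω_n)` for a compact ring `R`: the sets `P_n + ω_n R[[T]]`
are nested and compact. -/
theorem exists_forall_omega_dvd_sub {p : ℕ} {R : Type*} [CommRing R] [TopologicalSpace R]
    [IsTopologicalRing R] [CompactSpace R] [T2Space R] (P : ℕ → R[X])
    (hP : ∀ n, omegaPoly p R n ∣ P (n + 1) - P n) :
    ∃ f : PowerSeries R, ∀ n,
      ((1 + PowerSeries.X) ^ p ^ n - 1 : PowerSeries R) ∣ f - (P n : PowerSeries R) := by
  have hc : CompactSpace (PowerSeries R) := inferInstanceAs (CompactSpace ((Unit →₀ ℕ) → R))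
  let t : ℕ → Set (PowerSeries R) := fun n =>
    Set.range fun g : PowerSeries R => (P n : PowerSeries R) + (omegaPoly p R n : PowerSeries R) * g
  have hcomp : ∀ n, IsCompact (t n) := fun n => isCompact_range (by fun_prop)
  have hsub : ∀ n, t (n + 1) ⊆ t n := by
    rintro n - ⟨g, rfl⟩
    obtain ⟨A, hA⟩ := hP n
    obtain ⟨B, hB⟩ := omegaPoly_dvd_succ p R n
    refine ⟨(A : PowerSeries R) + (B : PowerSeries R) * g, ?_⟩
    have hA' : P (n + 1) = P n + omegaPoly p R n * A := by rw [← hA]; ring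
    simp only [hA', hB, coe_add, coe_mul]
    ring
  obtain ⟨f, hf⟩ := IsCompact.nonempty_iInter_of_sequence_nonempty_isCompact_isClosed t hsub
    (fun n => Set.range_nonempty _) (hcomp 0) fun n => (hcomp n).isClosed
  refine ⟨f, fun n => ?_⟩
  obtain ⟨g, rfl⟩ := Set.mem_iInter.1 hf n
  rw [← coe_omegaPoly]
  exact ⟨g, by ring⟩

/-- In characteristic `p` a power series `F ≡ ∑ c_{n,i} (1 + T)^i mod ω_n` has derivative zero if
and only if only exponents divisible by `p` occur: `ω_n = T^{p^n}` has derivative zero, and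
`(1 + T) d/dT` multiplies `(1 + T)^i` by `i`. -/
theorem derivative_eq_zero_iff {p : ℕ} [Fact p.Prime] {k : Type*} [Field k] [CharP k p]
    {F : PowerSeries k} (c : ℕ → ℕ → k)
    (hF : ∀ n, ((1 + PowerSeries.X) ^ p ^ n - 1 : PowerSeries k) ∣
      F - ((∑ i ∈ Finset.range (p ^ n), C (c n i) * (1 + X) ^ i : k[X]) : PowerSeries k)) :
    PowerSeries.derivative k F = 0 ↔ ∀ n ≠ 0, ∀ i < p ^ n, ¬ p ∣ i → c n i = 0 := by
  have hp : p.Prime := Fact.out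
  set P : ℕ → k[X] := fun n => ∑ i ∈ Finset.range (p ^ n), C (c n i) * (1 + X) ^ i with hPdef
  have hdP : ∀ n, (1 + X) * derivative (P n) =
      ∑ i ∈ Finset.range (p ^ n), C (c n i * i) * (1 + X) ^ i := by
    intro n
    simp only [hPdef, derivative_sum, Finset.mul_sum]
    refine Finset.sum_congr rfl fun i _ => ?_
    rcases i with _ | i
    · simp
    · simp only [derivative_mul, derivative_C, zero_mul, zero_add, derivative_pow, derivative_add,
        derivative_one, derivative_X, mul_one, Nat.add_sub_cancel, map_mul]
      ring
  have key : ∀ n ≠ 0, (PowerSeries.X ^ p ^ n : PowerSeries k) ∣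
      PowerSeries.derivative k F - ((derivative (P n) : k[X]) : PowerSeries k) := by
    intro n hn
    obtain ⟨h, hh⟩ := hF n
    have : CharP (PowerSeries k) p := charP_of_injective_algebraMap
      (FaithfulSMul.algebraMap_injective k (PowerSeries k)) p
    rw [add_pow_char_pow, one_pow, add_sub_cancel_left] at hh
    have h1 := congrArg (PowerSeries.derivative k) hh
    refine ⟨PowerSeries.derivative k h, ?_⟩
    rw [map_sub, PowerSeries.derivative_coe, Derivation.leibniz, Derivation.leibniz_pow] at h1
    rw [h1]
    have h0 : ((p ^ n : ℕ) : PowerSeries k) = 0 := by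
      rw [Nat.cast_pow, CharP.cast_eq_zero, zero_pow hn]
    simp [← Nat.cast_smul_eq_nsmul (PowerSeries k), h0]
  constructor
  · intro h n hn i hi hpi
    have h1 := key n hn
    rw [h, zero_sub, dvd_neg] at h1
    have hdeg : (derivative (P n)).natDegree < p ^ n := by
      have h2 : (P n).natDegree ≤ p ^ n - 1 := by
        refine natDegree_sum_le_of_forall_le _ _ fun j hj => ?_
        refine (natDegree_C_mul_le _ _).trans ?_
        refine natDegree_pow_le.trans ?_
        rw [add_comm, show (1 : k[X]) = C 1 from rfl, natDegree_X_add_C, mul_one]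
        have := Finset.mem_range.1 hj
        omega
      have h3 := natDegree_derivative_le (P n)
      have := pow_pos hp.pos n
      omega
    have h2 : derivative (P n) = 0 := by
      ext j
      by_cases hj : j < p ^ n
      · have := PowerSeries.X_pow_dvd_iff.1 h1 j hj
        rwa [coeff_coe] at this
      · rw [coeff_eq_zero_of_natDegree_lt (hdeg.trans_le (not_lt.1 hj)), coeff_zero]
    have h3 := hdP n
    rw [h2, mul_zero] at h3
    have h4 := congrArg (fun Q : k[X] => (Q.comp (X - 1)).coeff i) h3
    simp only [zero_comp, coeff_zero, Polynomial.sum_comp, mul_comp, C_comp, pow_comp, add_comp,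
      one_comp, X_comp, add_sub_cancel, finsetSum_coeff, coeff_C_mul, coeff_X_pow] at h4
    simp only [mul_ite, mul_one, mul_zero, Finset.sum_ite_eq, Finset.mem_range, hi, if_true] at h4
    exact (mul_eq_zero.1 h4.symm).resolve_right fun h0 => hpi ((CharP.cast_eq_zero_iff k p i).1 h0)
  · intro h
    ext d
    have hd : d < p ^ (d + 1) := (Nat.lt_succ_self d).trans (Nat.lt_pow_self hp.one_lt)
    have h1 := hdP (d + 1)
    rw [Finset.sum_eq_zero, mul_eq_zero] at h1
    · have h2 : derivative (P (d + 1)) = 0 := h1.resolve_left fun h0 => by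
        simpa using congrArg (eval 0) h0
      have h3 := key (d + 1) d.succ_ne_zero
      rw [h2, coe_zero, sub_zero] at h3
      simpa using PowerSeries.X_pow_dvd_iff.1 h3 d hd
    · intro i hi
      by_cases hpi : p ∣ i
      · rw [(CharP.cast_eq_zero_iff k p i).2 hpi]; simp
      · rw [h _ d.succ_ne_zero i (Finset.mem_range.1 hi) hpi]; simp

end PowerSeriesModOmega

/-! ### The valuation ring of a finite extension of `ℚ_p` -/

section ValuationRing

theorem charZero_OL (p : ℕ) [Fact p.Prime] (L : Type*) [Field L] [Algebra ℚ_[p] L]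
    [Algebra ℤ_[p] L] : CharZero (OL p L) := by
  have : CharZero L := charZero_of_injective_algebraMap (algebraMap ℚ_[p] L).injective
  exact ⟨fun m n h => by
    have := congrArg (fun x : OL p L => (x : L)) h
    exact_mod_cast this⟩

variable (p : ℕ) [Fact p.Prime] (L : Type*) [Field L] [Algebra ℚ_[p] L] [FiniteDimensional ℚ_[p] L]
  [Algebra ℤ_[p] L] [IsScalarTower ℤ_[p] ℚ_[p] L]

theorem isIntegral_iff_spectralNorm_le_one (x : L) :
    IsIntegral ℤ_[p] x ↔ spectralNorm ℚ_[p] L x ≤ 1 := by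
  have hx : IsIntegral ℚ_[p] x := Algebra.IsIntegral.isIntegral x
  rw [spectralNorm, spectralValue_le_one_iff (minpoly.monic hx)]
  constructor
  · intro h n
    rw [minpoly.isIntegrallyClosed_eq_field_fractions' ℚ_[p] h, coeff_map]
    exact PadicInt.norm_le_one _
  · intro h
    have hl : minpoly ℚ_[p] x ∈ Polynomial.lifts (algebraMap ℤ_[p] ℚ_[p]) := by
      rw [Polynomial.lifts_iff_coeff_lifts]
      exact fun n => ⟨⟨_, h n⟩, rfl⟩
    obtain ⟨q, hq, -, hqm⟩ := Polynomial.lifts_and_degree_eq_and_monic hl (minpoly.monic hx)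
    refine ⟨q, hqm, ?_⟩
    have := minpoly.aeval ℚ_[p] x
    rwa [← hq, aeval_map_algebraMap, aeval_def] at this

theorem finite_OL : Module.Finite ℤ_[p] (OL p L) :=
  IsIntegralClosure.finite ℤ_[p] ℚ_[p] L _

theorem isDedekindDomain_OL : IsDedekindDomain (OL p L) :=
  integralClosure.isDedekindDomain ℤ_[p] ℚ_[p] L

theorem isUnit_OL_iff (x : OL p L) : IsUnit x ↔ spectralNorm ℚ_[p] L x = 1 := by
  have hle : ∀ y : OL p L, spectralAlgNorm ℚ_[p] L y ≤ 1 := fun y =>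
    (isIntegral_iff_spectralNorm_le_one p L y).1 y.2
  constructor
  · rintro ⟨u, rfl⟩
    refine le_antisymm (hle _) ?_
    have h1 : spectralAlgNorm ℚ_[p] L ((u : OL p L) : L) *
        spectralAlgNorm ℚ_[p] L ((u⁻¹ : (OL p L)ˣ) : OL p L) = 1 := by
      rw [← spectralAlgNorm_mul, ← MulMemClass.coe_mul, Units.mul_inv, OneMemClass.coe_one,
        spectralAlgNorm_one]
    calc (1 : ℝ) = _ := h1.symm
      _ ≤ spectralAlgNorm ℚ_[p] L ((u : OL p L) : L) * 1 :=
        mul_le_mul_of_nonneg_left (hle _) (apply_nonneg _ _)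
      _ = _ := mul_one _
  · intro h
    have hx0 : (x : L) ≠ 0 := by
      intro h0
      rw [h0, spectralNorm_zero] at h
      exact zero_ne_one h
    have h1 : spectralAlgNorm ℚ_[p] L (x : L) * spectralAlgNorm ℚ_[p] L (x : L)⁻¹ = 1 := by
      rw [← spectralAlgNorm_mul, mul_inv_cancel₀ hx0, spectralAlgNorm_one]
    have h2 : IsIntegral ℤ_[p] (x : L)⁻¹ := by
      rw [isIntegral_iff_spectralNorm_le_one]
      rw [spectralAlgNorm_def, h, one_mul] at h1
      exact h1.le
    exact IsUnit.of_mul_eq_one ⟨_, h2⟩ (Subtype.ext (mul_inv_cancel₀ hx0))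

theorem isLocalRing_OL : IsLocalRing (OL p L) := by
  refine IsLocalRing.of_nonunits_add fun {x y} hx hy => ?_
  have hle : ∀ y : OL p L, spectralNorm ℚ_[p] L y ≤ 1 := fun y =>
    (isIntegral_iff_spectralNorm_le_one p L y).1 y.2
  rw [mem_nonunits_iff, isUnit_OL_iff] at hx hy ⊢
  refine ne_of_lt ((isNonarchimedean_spectralNorm (K := ℚ_[p]) (L := L) x y).trans_lt ?_)
  exact max_lt (lt_of_le_of_ne (hle x) hx) (lt_of_le_of_ne (hle y) hy)

theorem not_isUnit_natCast_OL : ¬ IsUnit (p : OL p L) := by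
  rw [isUnit_OL_iff]
  have h : ((p : OL p L) : L) = algebraMap ℚ_[p] L p := by simp
  rw [h, spectralNorm_extends]
  exact ne_of_lt Padic.norm_p_lt_one

variable {p L}

theorem isMaximal_span_of_irreducible {π : OL p L} (hπ : Irreducible π) :
    (Ideal.span {π}).IsMaximal := by
  have := isLocalRing_OL p L
  have := isDedekindDomain_OL p L
  have hpid : IsPrincipalIdealRing (OL p L) := IsPrincipalIdealRing.of_isNoetherianRing_of_isBezout
  exact PrincipalIdealRing.isMaximal_of_irreducible hπ

theorem isUnit_iff_not_dvd {π : OL p L} (hπ : Irreducible π) (x : OL p L) :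
    IsUnit x ↔ ¬ π ∣ x := by
  have := isLocalRing_OL p L
  have h1 := IsLocalRing.eq_maximalIdeal (isMaximal_span_of_irreducible hπ)
  rw [← Ideal.mem_span_singleton, h1, IsLocalRing.mem_maximalIdeal, mem_nonunits_iff, not_not]

theorem dvd_natCast {π : OL p L} (hπ : Irreducible π) : π ∣ (p : OL p L) := by
  by_contra h
  exact not_isUnit_natCast_OL p L ((isUnit_iff_not_dvd hπ _).2 h)

theorem eq_zero_of_forall_pow_dvd (x : OL p L) (hx : ∀ n, (p : OL p L) ^ n ∣ x) : x = 0 := by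
  have := isLocalRing_OL p L
  have := isDedekindDomain_OL p L
  have h := Ideal.iInf_pow_eq_bot_of_isDomain (Ideal.span {(p : OL p L)}) (by
    rw [Ne, Ideal.span_singleton_eq_top]
    exact not_isUnit_natCast_OL p L)
  rw [← Ideal.mem_bot, ← h, Ideal.mem_iInf]
  intro n
  rw [Ideal.span_singleton_pow, Ideal.mem_span_singleton]
  exact hx n

/-- `O_L` with its topology as a finite `ℤ_p`-module is a compact Hausdorff ring. -/
theorem exists_compact_topology_OL : ∃ τ : TopologicalSpace (OL p L),
    @IsTopologicalRing (OL p L) τ _ ∧ @CompactSpace (OL p L) τ ∧ @T2Space (OL p L) τ := by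
  have := finite_OL p L
  have hfree : Module.Free ℤ_[p] (OL p L) := by
    have : Module.IsTorsionFree ℤ_[p] L :=
      Module.IsTorsionFree.trans_faithfulSMul ℤ_[p] ℚ_[p] L
    infer_instance
  let τ : TopologicalSpace (OL p L) := moduleTopology ℤ_[p] (OL p L)
  have : IsModuleTopology ℤ_[p] (OL p L) := ⟨rfl⟩
  have := IsModuleTopology.toContinuousAdd ℤ_[p] (OL p L)
  let b := Module.Free.chooseBasis ℤ_[p] (OL p L)
  let e := b.equivFun
  have he : Continuous e := IsModuleTopology.continuous_of_linearMap e.toLinearMap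
  have he' : Continuous e.symm := IsModuleTopology.continuous_of_linearMap e.symm.toLinearMap
  let h : OL p L ≃ₜ (Module.Free.ChooseBasisIndex ℤ_[p] (OL p L) → ℤ_[p]) :=
    ⟨e.toEquiv, he, he'⟩
  exact ⟨τ, IsModuleTopology.isTopologicalRing ℤ_[p] (OL p L), h.symm.compactSpace, h.symm.t2Space⟩

end ValuationRing

/-! ### Linear independence of dilated rational functions in characteristic `p` -/

section Independence

variable {p : ℕ} [Fact p.Prime] {k : Type*} [Field k]

theorem pow_prime_pow_eq_one_iff [CharP k p] {α : k} (n : ℕ) : α ^ p ^ n = 1 ↔ α = 1 := by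
  rw [← sub_eq_zero, ← one_pow (p ^ n), ← sub_pow_char_pow,
    pow_eq_zero_iff (pow_ne_zero _ (Fact.out : p.Prime).ne_zero), sub_eq_zero, one_pow]

variable (k) in
/-- The reduction `k[ℤ_p] → k[ℤ/p^N]` of group algebras. -/
def reduceHom (N : ℕ) : AddMonoidAlgebra k ℤ_[p] →+* AddMonoidAlgebra k (ZMod (p ^ N)) :=
  AddMonoidAlgebra.mapDomainRingHom k (PadicInt.toZModPow N).toAddMonoidHom

theorem reduceHom_single (N : ℕ) (x : ℤ_[p]) (r : k) :
    reduceHom k N (AddMonoidAlgebra.single x r) =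
      AddMonoidAlgebra.single (PadicInt.toZModPow N x) r := by
  rw [reduceHom, AddMonoidAlgebra.mapDomainRingHom_apply, AddMonoidAlgebra.mapDomain_single]
  rfl

theorem exists_injOn_toZModPow (m : ℕ) (s : Finset ℤ_[p]) :
    ∃ N ≥ m, Set.InjOn (PadicInt.toZModPow N) (s : Set ℤ_[p]) := by
  classical
  have hex : ∀ y : ℤ_[p] × ℤ_[p], ∃ N, y.1 ≠ y.2 →
      PadicInt.toZModPow N y.1 ≠ PadicInt.toZModPow N y.2 := by
    intro y
    by_contra! h
    exact (h 0).1 (PadicInt.ext_of_toZModPow.1 fun n => (h n).2)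
  choose f hf using hex
  refine ⟨(s ×ˢ s).sup f ⊔ m, le_max_right _ _, fun y hy y' hy' h => ?_⟩
  by_contra hne
  refine hf (y, y') hne ?_
  rw [toZModPow_eq_iff_dvd] at h ⊢
  refine (pow_dvd_pow _ ?_).trans h
  exact (Finset.le_sup (f := f) (Finset.mem_product.2 ⟨hy, hy'⟩ : (y, y') ∈ s ×ˢ s)).trans
    (le_max_left _ _)

/-- `k[ℤ_p]` embeds into `lim k[ℤ/p^N]`. -/
theorem eq_zero_of_forall_reduceHom (m : ℕ) (x : AddMonoidAlgebra k ℤ_[p])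
    (h : ∀ N ≥ m, reduceHom k N x = 0) : x = 0 := by
  obtain ⟨N, hN, hinj⟩ := exists_injOn_toZModPow m x.coeff.support
  have h1 := congrArg AddMonoidAlgebra.coeff (h N hN)
  rw [reduceHom, AddMonoidAlgebra.mapDomainRingHom_apply, AddMonoidAlgebra.coeff_mapDomain] at h1
  rw [← AddMonoidAlgebra.coeff_eq_zero]
  refine Finsupp.mapDomain_injOn (M := k) _ hinj (by simp) (by simp) ?_
  rw [Finsupp.mapDomain_zero]
  exact h1

/-- For a unit `η` and `j ≡ η z₀ mod p^m`, the map `i ↦ η⁻¹ (j + p^m i)` is a bijection from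
`{0, …, p^{N-m} - 1}` onto the classes modulo `p^N` which are `≡ z₀ mod p^m`. -/
theorem sum_coset_eq {m N : ℕ} (hmN : m ≤ N) (z₀ : ℤ_[p]) (η : ℤ_[p]ˣ) {M : Type*}
    [AddCommMonoid M] (f : ZMod (p ^ N) → ℕ → M) :
    ∑ x : ZMod (p ^ N) with ZMod.castHom (pow_dvd_pow p hmN) (ZMod (p ^ m)) x =
        PadicInt.toZModPow m z₀, f x (PadicInt.toZModPow N (η : ℤ_[p]) * x).val =
      ∑ i ∈ Finset.range (p ^ (N - m)),
        f (PadicInt.toZModPow N (((η⁻¹ : ℤ_[p]ˣ) : ℤ_[p]) *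
            (((PadicInt.toZModPow m ((η : ℤ_[p]) * z₀)).val + p ^ m * i : ℕ) : ℤ_[p])))
          ((PadicInt.toZModPow m ((η : ℤ_[p]) * z₀)).val + p ^ m * i) := by
  have hp : p.Prime := Fact.out
  have hm0 : 0 < p ^ m := pow_pos hp.pos m
  have hmNpow : p ^ m * p ^ (N - m) = p ^ N := by rw [← pow_add, Nat.add_sub_cancel' hmN]
  set j := (PadicInt.toZModPow m ((η : ℤ_[p]) * z₀)).val with hj
  have hjlt : j < p ^ m := ZMod.val_lt _
  have hcast : ∀ y : ℤ_[p], ZMod.castHom (pow_dvd_pow p hmN) (ZMod (p ^ m))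
      (PadicInt.toZModPow N y) = PadicInt.toZModPow m y := fun y => by
    rw [ZMod.castHom_apply, PadicInt.cast_toZModPow m N hmN]
  have hinv : ∀ n : ℕ, PadicInt.toZModPow n ((η⁻¹ : ℤ_[p]ˣ) : ℤ_[p]) *
      PadicInt.toZModPow n (η : ℤ_[p]) = 1 := fun n => by
    rw [← map_mul, Units.inv_mul, map_one]
  -- the class `η x` is `j` modulo `p^m`
  have hmod : ∀ x : ZMod (p ^ N), ZMod.castHom (pow_dvd_pow p hmN) (ZMod (p ^ m)) x =
      PadicInt.toZModPow m z₀ → (PadicInt.toZModPow N (η : ℤ_[p]) * x).val % p ^ m = j := by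
    intro x hx
    have h1 : ((((PadicInt.toZModPow N (η : ℤ_[p]) * x).val : ℕ)) : ZMod (p ^ m)) = (j : ZMod (p ^ m)) := by
      rw [hj, ZMod.natCast_zmod_val, map_mul, ← hx, ← hcast, ← map_mul, ZMod.castHom_apply,
        ZMod.natCast_val]
    have h2 := (ZMod.natCast_eq_natCast_iff' _ _ _).1 h1
    rwa [Nat.mod_eq_of_lt hjlt] at h2
  have hlt : ∀ i ∈ Finset.range (p ^ (N - m)), j + p ^ m * i < p ^ N := by
    intro i hi
    have : p ^ m * (i + 1) ≤ p ^ m * p ^ (N - m) :=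
      Nat.mul_le_mul_left _ (Finset.mem_range.1 hi)
    rw [hmNpow, mul_add, mul_one] at this
    omega
  have hval : ∀ i ∈ Finset.range (p ^ (N - m)), (PadicInt.toZModPow N (η : ℤ_[p]) *
      PadicInt.toZModPow N (((η⁻¹ : ℤ_[p]ˣ) : ℤ_[p]) * ((j + p ^ m * i : ℕ) : ℤ_[p]))).val =
      j + p ^ m * i := by
    intro i hi
    rw [← map_mul, Units.mul_inv_cancel_left, map_natCast, ZMod.val_natCast_of_lt (hlt i hi)]
  refine Finset.sum_bij' (fun x _ => (PadicInt.toZModPow N (η : ℤ_[p]) * x).val / p ^ m)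
    (fun i _ => PadicInt.toZModPow N (((η⁻¹ : ℤ_[p]ˣ) : ℤ_[p]) * ((j + p ^ m * i : ℕ) : ℤ_[p])))
    ?_ ?_ ?_ ?_ ?_
  · intro x hx
    rw [Finset.mem_range, Nat.div_lt_iff_lt_mul hm0, mul_comm (p ^ (N - m)), hmNpow]
    exact ZMod.val_lt _
  · intro i hi
    rw [Finset.mem_filter, hcast]
    refine ⟨Finset.mem_univ _, ?_⟩
    have h0 : ((p ^ m : ℕ) : ZMod (p ^ m)) = 0 := ZMod.natCast_self _
    rw [map_mul, map_natCast, Nat.cast_add, Nat.cast_mul, h0, zero_mul, add_zero, hj,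
      ZMod.natCast_zmod_val, map_mul, ← mul_assoc, hinv, one_mul]
  · intro x hx
    have h1 := hmod x (Finset.mem_filter.1 hx).2
    have h2 : j + p ^ m * ((PadicInt.toZModPow N (η : ℤ_[p]) * x).val / p ^ m) =
        (PadicInt.toZModPow N (η : ℤ_[p]) * x).val := by
      rw [← h1, Nat.mod_add_div]
    simp only [h2]
    rw [map_mul, map_natCast, ZMod.natCast_zmod_val, ← mul_assoc, hinv, one_mul]
  · intro i hi
    simp only [hval i hi]
    rw [Nat.add_mul_div_left _ _ hm0, Nat.div_eq_of_lt hjlt, zero_add]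
  · intro x hx
    have h1 := hmod x (Finset.mem_filter.1 hx).2
    have h2 : j + p ^ m * ((PadicInt.toZModPow N (η : ℤ_[p]) * x).val / p ^ m) =
        (PadicInt.toZModPow N (η : ℤ_[p]) * x).val := by
      rw [← h1, Nat.mod_add_div]
    simp only [h2]
    rw [map_mul, map_natCast, ZMod.natCast_zmod_val, ← mul_assoc, hinv, one_mul]

/-- The unit group of an algebraically closed field is divisible, so a homomorphism from `ℤ`
extends to `ℤ_p`. -/
theorem exists_hom_to_units {E : Type*} [Field E] [IsAlgClosed E] (u : Eˣ) :
    ∃ χ : Multiplicative ℤ_[p] →* Eˣ, χ (Multiplicative.ofAdd 1) = u := by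
  have : DivisibleBy (Additive Eˣ) ℕ := divisibleByOfSMulRightSurj _ _ fun {n} hn x => by
    obtain ⟨z, hz⟩ := IsAlgClosed.exists_pow_nat_eq ((Additive.toMul x : Eˣ) : E)
      (Nat.pos_of_ne_zero hn)
    have hz0 : z ≠ 0 := by
      rintro rfl
      rw [zero_pow hn] at hz
      exact (Additive.toMul x).ne_zero hz.symm
    refine ⟨Additive.ofMul (Units.mk0 z hz0), ?_⟩
    apply Additive.toMul.injective
    ext
    simpa using hz
  have : DivisibleBy (Additive Eˣ) ℤ := AddGroup.divisibleByIntOfDivisibleByNat _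
  obtain ⟨h, hh⟩ := (Module.Baer.of_divisible (Additive Eˣ)).extension_property_addMonoidHom
    (Int.castAddHom ℤ_[p]) Int.cast_injective (zmultiplesHom _ (Additive.ofMul u))
  refine ⟨AddMonoidHom.toMultiplicativeLeft h, ?_⟩
  have h1 := DFunLike.congr_fun hh 1
  simp only [AddMonoidHom.comp_apply, Int.coe_castAddHom, Int.cast_one, zmultiplesHom_apply,
    one_smul] at h1
  rw [AddMonoidHom.toMultiplicativeLeft_apply_apply, toAdd_ofAdd, h1]
  rfl

/-- A ring homomorphism from `k[ℤ_p]` to a domain which sends `α^j [j]` to `1` for all natural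
numbers `j`, but no `r [x]` with `x` irrational: it is `[x] ↦ χ(x) [x mod ℚ]`, where
`χ : ℤ_p → k̄ˣ` has `χ(1) = α⁻¹`. -/
theorem exists_specialization {α : k} (hα : α ≠ 0) :
    ∃ Φ : AddMonoidAlgebra k ℤ_[p] →+*
        AddMonoidAlgebra (AlgebraicClosure k) (ℚ_[p] ⧸ Submodule.span ℚ {(1 : ℚ_[p])}),
      (∀ (x : ℤ_[p]) (r : k), r ≠ 0 → Φ (AddMonoidAlgebra.single x r) ≠ 0) ∧
      (∀ j : ℕ, Φ (AddMonoidAlgebra.single (j : ℤ_[p]) (α ^ j)) = 1) ∧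
      (∀ (x : ℤ_[p]) (r : k), Φ (AddMonoidAlgebra.single x r) = 1 → ∃ q : ℚ, (q : ℚ_[p]) = x) := by
  let E := AlgebraicClosure k
  let V := ℚ_[p] ⧸ Submodule.span ℚ {(1 : ℚ_[p])}
  have hα' : algebraMap k E α ≠ 0 := by simpa using hα
  obtain ⟨χ, hχ⟩ := exists_hom_to_units (p := p) (Units.mk0 _ hα')⁻¹
  let q : ℤ_[p] → V := fun x => Submodule.Quotient.mk (x : ℚ_[p])
  let F : Multiplicative ℤ_[p] →* AddMonoidAlgebra E V :=
    { toFun := fun x => AddMonoidAlgebra.single (q x.toAdd) ((χ x : Eˣ) : E)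
      map_one' := by
        rw [map_one χ, toAdd_one, Units.val_one, AddMonoidAlgebra.one_def]
        congr 1
      map_mul' := fun x y => by
        rw [map_mul χ, toAdd_mul, Units.val_mul, AddMonoidAlgebra.single_mul_single]
        congr 1 }
  let Φ := AddMonoidAlgebra.lift k (AddMonoidAlgebra E V) ℤ_[p] F
  have hΦ : ∀ x r, Φ (AddMonoidAlgebra.single x r) =
      AddMonoidAlgebra.single (q x) (algebraMap k E r * (χ (Multiplicative.ofAdd x) : Eˣ)) := by
    intro x r
    rw [AddMonoidAlgebra.lift_single]
    change r • AddMonoidAlgebra.single (q x) ((χ (Multiplicative.ofAdd x) : Eˣ) : E) = _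
    rw [AddMonoidAlgebra.smul_single, Algebra.smul_def]
  refine ⟨(Φ : AddMonoidAlgebra k ℤ_[p] →+* _), ?_, ?_, ?_⟩
  · intro x r hr
    rw [RingHom.coe_coe, hΦ, AddMonoidAlgebra.single_ne_zero]
    exact mul_ne_zero (by simpa using hr) (Units.ne_zero _)
  · intro j
    rw [RingHom.coe_coe, hΦ, AddMonoidAlgebra.one_def]
    congr 1
    · refine (Submodule.Quotient.mk_eq_zero _).2 (Submodule.mem_span_singleton.2 ⟨(j : ℚ), ?_⟩)
      simp [Rat.smul_def]
    · have : Multiplicative.ofAdd (j : ℤ_[p]) = Multiplicative.ofAdd (1 : ℤ_[p]) ^ j := by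
        rw [← ofAdd_nsmul, nsmul_one]
      rw [this, map_pow χ, hχ, map_pow, Units.val_pow_eq_pow_val, ← mul_pow, Units.val_inv_eq_inv_val,
        Units.val_mk0, mul_inv_cancel₀ hα', one_pow]
  · intro x r h
    rw [RingHom.coe_coe, hΦ, AddMonoidAlgebra.one_def, AddMonoidAlgebra.single_inj] at h
    have h1 : q x = 0 := by
      rcases h with h | h
      · exact h.1
      · exact absurd h.2 one_ne_zero
    obtain ⟨s, hs⟩ := Submodule.mem_span_singleton.1 ((Submodule.Quotient.mk_eq_zero _).1 h1)
    exact ⟨s, by rw [← hs]; simp [Rat.smul_def]⟩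

/-- Linear independence of the measures on `z₀ + p^m ℤ_p` attached to the functions
`z ↦ α^{[η z]}`, where `[x]` is the least non-negative residue of `x` modulo `p^N`, for units `η`
with irrational ratios. In `k[[ℤ_p]]` the measure of `η` is the rational expression
`α^j [η⁻¹ j] / (1 - α^{p^m} [η⁻¹ p^m])`; after clearing denominators the relation takes place in
`k[ℤ_p]`, where it is specialized at a zero of the denominator that belongs to `η = 1`. -/
theorem coeff_one_eq_zero [CharP k p] {α : k} (hα0 : α ≠ 0) (hα1 : α ≠ 1) (m : ℕ) (z₀ : ℤ_[p])
    (S : Finset ℤ_[p]ˣ) (c : ℤ_[p]ˣ → k) (h1S : 1 ∈ S)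
    (hS : ∀ η ∈ S, η ≠ 1 → (∀ q : ℚ, (q : ℚ_[p]) ≠ ((η : ℤ_[p]) : ℚ_[p])) ∨
      (η = -1 ∧ α ^ 2 ≠ 1))
    (H : ∀ N ≥ m, ∀ z : ℤ_[p], (p : ℤ_[p]) ^ m ∣ z - z₀ →
      ∑ η ∈ S, c η * α ^ (PadicInt.toZModPow N ((η : ℤ_[p]) * z)).val = 0) : c 1 = 0 := by
  classical
  have hp : p.Prime := Fact.out
  let j : ℤ_[p]ˣ → ℕ := fun η => (PadicInt.toZModPow m ((η : ℤ_[p]) * z₀)).val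
  let Y : ℤ_[p]ˣ → AddMonoidAlgebra k ℤ_[p] := fun η =>
    AddMonoidAlgebra.single (((η⁻¹ : ℤ_[p]ˣ) : ℤ_[p]) * ((p ^ m : ℕ) : ℤ_[p])) (α ^ p ^ m)
  let B : ℤ_[p]ˣ → AddMonoidAlgebra k ℤ_[p] := fun η =>
    AddMonoidAlgebra.single (((η⁻¹ : ℤ_[p]ˣ) : ℤ_[p]) * (j η : ℤ_[p])) (c η * α ^ j η)
  let d : ℕ → ℤ_[p]ˣ → AddMonoidAlgebra k ℤ_[p] := fun N η =>
    B η * ∑ i ∈ Finset.range (p ^ (N - m)), Y η ^ i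
  have hd0 : ∀ N ≥ m, reduceHom k N (∑ η ∈ S, d N η) = 0 := by
    intro N hN
    have hd1 : ∀ η, reduceHom k N (d N η) =
        ∑ x : ZMod (p ^ N) with ZMod.castHom (pow_dvd_pow p hN) (ZMod (p ^ m)) x =
          PadicInt.toZModPow m z₀,
          AddMonoidAlgebra.single x (c η * α ^ (PadicInt.toZModPow N (η : ℤ_[p]) * x).val) := by
      intro η
      rw [sum_coset_eq hN z₀ η fun x e => AddMonoidAlgebra.single x (c η * α ^ e)]
      simp only [d, Finset.mul_sum, map_sum]
      refine Finset.sum_congr rfl fun i _ => ?_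
      rw [← reduceHom_single]
      congr 1
      simp only [B, Y, AddMonoidAlgebra.single_pow, AddMonoidAlgebra.single_mul_single]
      congr 1
      · simp only [j, nsmul_eq_mul]; push_cast; ring
      · simp only [j]; ring
    rw [map_sum, Finset.sum_congr rfl fun η _ => hd1 η, Finset.sum_comm]
    refine Finset.sum_eq_zero fun x hx => ?_
    obtain ⟨z, rfl⟩ : ∃ z : ℤ_[p], PadicInt.toZModPow N z = x :=
      ⟨(x.val : ℤ_[p]), by rw [map_natCast, ZMod.natCast_zmod_val]⟩
    have hz : (p : ℤ_[p]) ^ m ∣ z - z₀ := by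
      have h2 := (Finset.mem_filter.1 hx).2
      rwa [ZMod.castHom_apply, PadicInt.cast_toZModPow m N hN, toZModPow_eq_iff_dvd] at h2
    have h3 := H N hN z hz
    simp only [map_mul] at h3
    rw [← AddMonoidAlgebra.coeff_inj]
    simp only [AddMonoidAlgebra.coeff_sum, AddMonoidAlgebra.coeff_single, AddMonoidAlgebra.coeff_zero]
    rw [← Finsupp.single_finsetSum, h3, Finsupp.single_zero]
  -- the relation with denominators cleared
  have hrel : ∑ η ∈ S, B η * ∏ η' ∈ S.erase η, (1 - Y η') = 0 := by
    refine eq_zero_of_forall_reduceHom m _ fun N hN => ?_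
    have hY : ∀ η, reduceHom k N (Y η ^ p ^ (N - m)) = AddMonoidAlgebra.single 0 (α ^ p ^ N) := by
      intro η
      simp only [Y, AddMonoidAlgebra.single_pow, reduceHom_single]
      congr 1
      · have h0 : ((p ^ N : ℕ) : ZMod (p ^ N)) = 0 := ZMod.natCast_self _
        rw [nsmul_eq_mul, mul_left_comm, ← Nat.cast_mul, ← pow_add, Nat.sub_add_cancel hN,
          map_mul, map_natCast, h0, mul_zero]
      · rw [← pow_mul, ← pow_add, Nat.add_sub_cancel' hN]
    have hmul : AddMonoidAlgebra.single (0 : ZMod (p ^ N)) (1 - α ^ p ^ N) *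
        reduceHom k N (∑ η ∈ S, B η * ∏ η' ∈ S.erase η, (1 - Y η')) = 0 := by
      have h2 : ∀ η ∈ S, AddMonoidAlgebra.single (0 : ZMod (p ^ N)) (1 - α ^ p ^ N) *
          reduceHom k N (B η * ∏ η' ∈ S.erase η, (1 - Y η')) =
          reduceHom k N (d N η) * reduceHom k N (∏ η' ∈ S, (1 - Y η')) := by
        intro η hη
        rw [← map_mul, ← Finset.mul_prod_erase S _ hη]
        have h3 : d N η * ((1 - Y η) * ∏ η' ∈ S.erase η, (1 - Y η')) =
            (1 - Y η ^ p ^ (N - m)) * (B η * ∏ η' ∈ S.erase η, (1 - Y η')) := by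
          rw [← mul_neg_geom_sum]
          simp only [d]
          ring
        rw [h3, map_mul _ (1 - Y η ^ p ^ (N - m)), map_sub, map_one, hY,
          AddMonoidAlgebra.single_sub, ← AddMonoidAlgebra.one_def]
      rw [map_sum, Finset.mul_sum, Finset.sum_congr rfl h2, ← Finset.sum_mul, ← map_sum, hd0 N hN,
        zero_mul]
    have hinv : AddMonoidAlgebra.single (0 : ZMod (p ^ N)) (1 - α ^ p ^ N)⁻¹ *
        AddMonoidAlgebra.single (0 : ZMod (p ^ N)) (1 - α ^ p ^ N) = 1 := by
      rw [AddMonoidAlgebra.single_mul_single, add_zero,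
        inv_mul_cancel₀ (sub_ne_zero.2 (Ne.symm <| mt (pow_prime_pow_eq_one_iff N).1 hα1)), AddMonoidAlgebra.one_def]
    rw [← one_mul (reduceHom k N _), ← hinv, mul_assoc, hmul, mul_zero]
  obtain ⟨Φ, hΦ0, hΦ1, hΦ2⟩ := exists_specialization (p := p) hα0
  have hY1 : Φ (Y 1) = 1 := by
    simp only [Y, inv_one, Units.val_one, one_mul]
    exact hΦ1 (p ^ m)
  have h2 := congrArg Φ hrel
  rw [map_sum, map_zero, Finset.sum_eq_single 1] at h2
  · rw [map_mul, mul_eq_zero, map_prod, Finset.prod_eq_zero_iff] at h2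
    by_contra hc
    refine h2.elim (hΦ0 _ _ (mul_ne_zero hc (pow_ne_zero _ hα0))) ?_
    rintro ⟨η, hη, h3⟩
    rw [Finset.mem_erase] at hη
    rw [map_sub, map_one, sub_eq_zero] at h3
    rcases hS η hη.2 hη.1 with h4 | ⟨rfl, h4⟩
    · obtain ⟨q, hq⟩ := hΦ2 _ _ h3.symm
      refine h4 ((p : ℚ) ^ m / q) ?_
      have h5 : (((η : ℤ_[p]) : ℚ_[p])) * (q : ℚ_[p]) = (p : ℚ_[p]) ^ m := by
        rw [hq, ← PadicInt.coe_mul, Units.mul_inv_cancel_left]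
        push_cast
        rfl
      have hq0 : (q : ℚ_[p]) ≠ 0 := by
        intro h0
        rw [h0, mul_zero] at h5
        exact pow_ne_zero m (by exact_mod_cast hp.ne_zero) h5.symm
      push_cast
      rw [← h5, mul_div_cancel_right₀ _ hq0]
    · -- here `Y 1 * Y (-1) = α^(2 p^m)`
      have h5 : Φ (Y 1 * Y (-1)) = 1 := by rw [map_mul, hY1, ← h3, one_mul]
      have h6 : Y 1 * Y (-1) = AddMonoidAlgebra.single 0 ((α ^ 2) ^ p ^ m) := by
        simp only [Y, AddMonoidAlgebra.single_mul_single]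
        congr 1
        · simp
        · ring
      have h7 : Φ (AddMonoidAlgebra.single 0 ((α ^ 2) ^ p ^ m - 1)) = 0 := by
        rw [AddMonoidAlgebra.single_sub, map_sub, ← h6, h5, ← AddMonoidAlgebra.one_def, map_one,
          sub_self]
      have h8 : (α ^ 2) ^ p ^ m - 1 = 0 := by
        by_contra h9
        exact hΦ0 _ _ h9 h7
      exact h4 ((pow_prime_pow_eq_one_iff m).1 (sub_eq_zero.1 h8))
  · intro η _ hη
    rw [map_mul, map_prod, Finset.prod_eq_zero (Finset.mem_erase.2 ⟨hη.symm, h1S⟩), mul_zero]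
    rw [map_sub, map_one, hY1, sub_self]
  · exact fun h => (h h1S).elim

end Independence

/-! ### Polynomials representing the Mirimanoff elements -/

section MirimanoffPolynomial

variable {p : ℕ} [Fact p.Prime]

theorem gamma_eq_gammaZero_pow_iff_dvd (n i : ℕ) (u : ℤ_[p]ˣ) :
    gamma p n u = gammaZero p n ^ i ↔
      (p : ℤ_[p]) ^ (n + 1) ∣ (angle p u : ℤ_[p]) - (1 + p) ^ i := by
  rw [gammaZero_pow, gamma, sigmaPrincipal_eq_iff]
  simp

theorem one_add_p_pow_sub_dvd_iff (hp2 : p ≠ 2) (n i j : ℕ) :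
    (p : ℤ_[p]) ^ (n + 1) ∣ (1 + p) ^ i - (1 + p) ^ j ↔ i ≡ j [MOD p ^ n] := by
  rw [← gammaZero_pow_eq_iff_modEq hp2, gammaZero_pow, gammaZero_pow, sigmaPrincipal_eq_iff]
  simp

open Classical in
/-- The exponent `e < p^n` with `γ_n(k) = γ_0^e`, for `k` prime to `p`; it is the reduction of the
`p`-adic number `log ⟨k⟩ / log (1 + p)`. The value is `0` if `p ∣ k`. -/
def expo (p : ℕ) [Fact p.Prime] (n k : ℕ) : ℕ :=
  if hk : p ∣ k then 0 else
    if h : ∃ i < p ^ n, gamma p n (natUnit p k hk) = gammaZero p n ^ i then h.choose else 0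

theorem exists_gamma_eq (hp2 : p ≠ 2) (n : ℕ) (u : ℤ_[p]ˣ) :
    ∃ i < p ^ n, gamma p n u = gammaZero p n ^ i := by
  obtain ⟨i, hi, h⟩ := exists_pow_eq_of_congr_one hp2 n (angle p u) (angle_congr_one p u)
  exact ⟨i, hi, (gamma_eq_gammaZero_pow_iff n i u).2 h⟩

theorem gamma_eq_pow_expo (hp2 : p ≠ 2) (n : ℕ) {k : ℕ} (hk : ¬ p ∣ k) :
    gamma p n (natUnit p k hk) = gammaZero p n ^ expo p n k := by
  have h := exists_gamma_eq hp2 n (natUnit p k hk)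
  rw [expo, dif_neg hk, dif_pos h]
  exact h.choose_spec.2

theorem expo_lt (n k : ℕ) : expo p n k < p ^ n := by
  have hp : p.Prime := Fact.out
  rw [expo]
  split_ifs with hk h
  · exact pow_pos hp.pos n
  · exact h.choose_spec.1
  · exact pow_pos hp.pos n

theorem expo_eq_iff (hp2 : p ≠ 2) (n : ℕ) {k i : ℕ} (hk : ¬ p ∣ k) (hi : i < p ^ n) :
    expo p n k = i ↔
      (p : ℤ_[p]) ^ (n + 1) ∣ (angle p (natUnit p k hk) : ℤ_[p]) - (1 + p) ^ i := by
  rw [← gamma_eq_gammaZero_pow_iff_dvd, gamma_eq_pow_expo hp2, gammaZero_pow_eq_iff_modEq hp2]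
  exact ⟨fun h => h ▸ Nat.ModEq.refl _, fun h => h.eq_of_lt_of_lt (expo_lt n k) hi⟩

theorem pow_dvd_natCast_sub {m k k' : ℕ} (h : k ≡ k' [MOD p ^ m]) :
    (p : ℤ_[p]) ^ m ∣ (k : ℤ_[p]) - k' := by
  rw [← toZModPow_eq_iff_dvd, map_natCast, map_natCast, ZMod.natCast_eq_natCast_iff]
  exact h

theorem dvd_iff_of_modEq {p m k k' : ℕ} (hm : m ≠ 0) (h : k ≡ k' [MOD p ^ m]) :
    p ∣ k ↔ p ∣ k' :=
  (h.of_dvd (dvd_pow_self p hm)).dvd_iff dvd_rfl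

theorem expo_succ_modEq (hp2 : p ≠ 2) (n : ℕ) {k k' : ℕ} (h : k ≡ k' [MOD p ^ (n + 1)]) :
    expo p (n + 1) k ≡ expo p n k' [MOD p ^ n] := by
  by_cases hk : p ∣ k
  · have hk' := (dvd_iff_of_modEq n.succ_ne_zero h).1 hk
    rw [expo, expo, dif_pos hk, dif_pos hk']
  · have hk' := fun h' => hk ((dvd_iff_of_modEq n.succ_ne_zero h).2 h')
    have h1 := (gamma_eq_gammaZero_pow_iff_dvd _ _ _).1 (gamma_eq_pow_expo hp2 (n + 1) hk)
    have h2 := (gamma_eq_gammaZero_pow_iff_dvd _ _ _).1 (gamma_eq_pow_expo hp2 n hk')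
    have h3 := angle_sub_angle_dvd (p := p) (u := natUnit p k hk) (v := natUnit p k' hk')
      n.succ_ne_zero (pow_dvd_natCast_sub h)
    rw [← one_add_p_pow_sub_dvd_iff hp2]
    have h4 := dvd_sub (dvd_add h2 h3) ((pow_dvd_pow _ (Nat.le_succ _)).trans h1)
    convert h4 using 1
    ring

/-- The value `θ(k) ω(k)⁻¹` of the character `θω⁻¹` at a natural number, extended by `0` to the
multiples of `p`. -/
def weight (θ : DeltaChar p) (k : ℕ) : ℤ_[p] :=
  if hk : p ∣ k then 0 else
    ((charVal θ (natUnit p k hk) * (teich p (natUnit p k hk))⁻¹ : ℤ_[p]ˣ) : ℤ_[p])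

theorem weight_congr (θ : DeltaChar p) {k k' : ℕ} (h : k ≡ k' [MOD p]) :
    weight θ k = weight θ k' := by
  have h0 : k ≡ k' [MOD p ^ 1] := by rwa [pow_one]
  by_cases hk : p ∣ k
  · rw [weight, weight, dif_pos hk, dif_pos ((dvd_iff_of_modEq one_ne_zero h0).1 hk)]
  · have hk' := fun h' => hk ((dvd_iff_of_modEq one_ne_zero h0).2 h')
    have h1 : (p : ℤ_[p]) ∣ (natUnit p k hk : ℤ_[p]) - natUnit p k' hk' := by
      have := pow_dvd_natCast_sub h0
      rwa [pow_one] at this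
    rw [weight, weight, dif_neg hk, dif_neg hk', charVal_congr θ h1, teich_congr_of_congr h1]

variable {L : Type*} [Field L] [Algebra ℤ_[p] L]

/-- The coefficient `a^k / (a^{p^{n+1}} - 1) θ(k) ω(k)⁻¹` of `γ_n(k)` in `M_n(θ, a)`. -/
def mirimanoffCoeff (θ : DeltaChar p) (a : OL p L) (n k : ℕ) : OL p L :=
  a ^ k * Ring.inverse (a ^ p ^ (n + 1) - 1) * algebraMap ℤ_[p] (OL p L) (weight θ k)

/-- The polynomial `∑ a^k / (a^{p^{n+1}} - 1) θ(k) ω(k)⁻¹ (1 + X)^{e_n(k)}`, whose value at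
`γ_0 - 1` is `M_n(θ, a)`. -/
def mirimanoffPoly (θ : DeltaChar p) (a : OL p L) (n : ℕ) : (OL p L)[X] :=
  ∑ k ∈ Finset.range (p ^ (n + 1)), C (mirimanoffCoeff θ a n k) * (1 + X) ^ expo p n k

theorem mirimanoffCoeff_of_dvd (θ : DeltaChar p) (a : OL p L) (n : ℕ) {k : ℕ} (hk : p ∣ k) :
    mirimanoffCoeff θ a n k = 0 := by
  rw [mirimanoffCoeff, weight, dif_pos hk, map_zero, mul_zero]

theorem aeval_mirimanoffPoly (hp2 : p ≠ 2) (θ : DeltaChar p) (a : OL p L) (n : ℕ) :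
    aeval (MonoidAlgebra.single (gammaZero p n) (1 : OL p L) - 1 :
      MonoidAlgebra (OL p L) (Gam p n)) (mirimanoffPoly θ a n) = mirimanoffElement θ a n := by
  have hp : p.Prime := Fact.out
  have hpos : 0 < p ^ (n + 1) := pow_pos hp.pos _
  have hrange : Finset.range (p ^ (n + 1)) = insert 0 (Finset.Icc 1 (p ^ (n + 1) - 1)) := by
    ext k
    simp only [Finset.mem_range, Finset.mem_insert, Finset.mem_Icc]
    omega
  rw [mirimanoffPoly, mirimanoffElement, hrange, Finset.sum_insert (by simp),
    mirimanoffCoeff_of_dvd θ a n (dvd_zero p), C_0, zero_mul, zero_add, map_sum]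
  refine Finset.sum_congr rfl fun k _ => ?_
  by_cases hk : p ∣ k
  · rw [mirimanoffCoeff_of_dvd θ a n hk, dif_pos hk, C_0, zero_mul, map_zero]
  · rw [dif_neg hk, gamma_eq_pow_expo hp2, map_mul, aeval_C, map_pow, map_add, map_one, aeval_X,
      add_sub_cancel, MonoidAlgebra.single_pow, one_pow, ← Algebra.smul_def,
      MonoidAlgebra.smul_single, smul_eq_mul, mul_one, mirimanoffCoeff, weight, dif_neg hk]

theorem sum_range_mul {M : Type*} [AddCommMonoid M] (A B : ℕ) (f : ℕ → M) :
    ∑ k ∈ Finset.range (A * B), f k =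
      ∑ j ∈ Finset.range A, ∑ i ∈ Finset.range B, f (j + A * i) := by
  rw [Finset.sum_comm, mul_comm]
  induction B with
  | zero => simp
  | succ B ih =>
    rw [Finset.sum_range_succ, ← ih, add_mul, one_mul, Finset.sum_range_add]
    simp only [add_comm, mul_comm]

theorem sum_mirimanoffCoeff (θ : DeltaChar p) {a : OL p L}
    (ha : ∀ n, IsUnit (a ^ p ^ (n + 1) - 1)) (n j : ℕ) :
    ∑ i ∈ Finset.range p, mirimanoffCoeff θ a (n + 1) (j + p ^ (n + 1) * i) =
      mirimanoffCoeff θ a n j := by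
  have hw : ∀ i, weight θ (j + p ^ (n + 1) * i) = weight θ j := fun i =>
    weight_congr θ (by
      have : p ∣ p ^ (n + 1) * i := (dvd_pow_self p n.succ_ne_zero).mul_right i
      simp [Nat.ModEq, Nat.add_mod, Nat.mod_eq_zero_of_dvd this])
  have h1 : ∀ i, mirimanoffCoeff θ a (n + 1) (j + p ^ (n + 1) * i) =
      (a ^ p ^ (n + 1)) ^ i * (a ^ j * Ring.inverse (a ^ p ^ (n + 1 + 1) - 1) *
        algebraMap ℤ_[p] (OL p L) (weight θ j)) := fun i => by
    rw [mirimanoffCoeff, hw, pow_add, pow_mul]; ring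
  have h2 : (∑ i ∈ Finset.range p, (a ^ p ^ (n + 1)) ^ i) *
      Ring.inverse (a ^ p ^ (n + 1 + 1) - 1) = Ring.inverse (a ^ p ^ (n + 1) - 1) := by
    have h3 := geom_sum_mul (a ^ p ^ (n + 1)) p
    rw [← pow_mul, ← pow_succ] at h3
    calc _ = (∑ i ∈ Finset.range p, (a ^ p ^ (n + 1)) ^ i) *
          Ring.inverse (a ^ p ^ (n + 1 + 1) - 1) *
          ((a ^ p ^ (n + 1) - 1) * Ring.inverse (a ^ p ^ (n + 1) - 1)) := by
            rw [Ring.mul_inverse_cancel _ (ha n), mul_one]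
      _ = ((∑ i ∈ Finset.range p, (a ^ p ^ (n + 1)) ^ i) * (a ^ p ^ (n + 1) - 1)) *
          Ring.inverse (a ^ p ^ (n + 1 + 1) - 1) * Ring.inverse (a ^ p ^ (n + 1) - 1) := by ring
      _ = _ := by rw [h3, Ring.mul_inverse_cancel _ (ha (n + 1)), one_mul]
  rw [Finset.sum_congr rfl fun i _ => h1 i, ← Finset.sum_mul, mirimanoffCoeff, ← h2]
  ring

/-- The elements `M_n(θ, a)` are compatible: `∑_{k ≡ j} a^k / (a^{p^{n+2}} - 1)` over the residues
`k` modulo `p^{n+2}` above `j` is the geometric sum `a^j / (a^{p^{n+1}} - 1)`. -/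
theorem omegaPoly_dvd_mirimanoffPoly_sub (hp2 : p ≠ 2) (θ : DeltaChar p) {a : OL p L}
    (ha : ∀ n, IsUnit (a ^ p ^ (n + 1) - 1)) (n : ℕ) :
    omegaPoly p (OL p L) n ∣ mirimanoffPoly θ a (n + 1) - mirimanoffPoly θ a n := by
  have h1 : mirimanoffPoly θ a n = ∑ j ∈ Finset.range (p ^ (n + 1)), ∑ i ∈ Finset.range p,
      C (mirimanoffCoeff θ a (n + 1) (j + p ^ (n + 1) * i)) * (1 + X) ^ expo p n j := by
    rw [mirimanoffPoly]
    refine Finset.sum_congr rfl fun j _ => ?_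
    rw [← sum_mirimanoffCoeff θ ha n j, map_sum, Finset.sum_mul]
  have h2 : mirimanoffPoly θ a (n + 1) = ∑ j ∈ Finset.range (p ^ (n + 1)), ∑ i ∈ Finset.range p,
      C (mirimanoffCoeff θ a (n + 1) (j + p ^ (n + 1) * i)) *
        (1 + X) ^ expo p (n + 1) (j + p ^ (n + 1) * i) := by
    rw [mirimanoffPoly, pow_succ p (n + 1), sum_range_mul]
  rw [h1, h2, ← Finset.sum_sub_distrib]
  refine Finset.dvd_sum fun j _ => ?_
  rw [← Finset.sum_sub_distrib]
  refine Finset.dvd_sum fun i _ => ?_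
  rw [← mul_sub]
  refine (omegaPoly_dvd_pow_sub_pow p _ (expo_succ_modEq hp2 n ?_)).mul_left _
  simp [Nat.ModEq]

theorem isMirimanoffSeries_iff (hp2 : p ≠ 2) (θ : DeltaChar p) (a : OL p L)
    (M : PowerSeries (OL p L)) :
    IsMirimanoffSeries θ a M ↔ ∀ n, ((1 + PowerSeries.X) ^ p ^ n - 1 : PowerSeries (OL p L)) ∣
      M - (mirimanoffPoly θ a n : PowerSeries (OL p L)) := by
  have hp : p.Prime := Fact.out
  refine forall_congr' fun n => ⟨?_, fun h => ⟨_, h, aeval_mirimanoffPoly hp2 θ a n⟩⟩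
  rintro ⟨P, hP, hPe⟩
  obtain ⟨Q, hQ⟩ := omegaPoly_dvd_of_aeval_eq_zero hp.pos (gammaZero_pow_eq_iff_modEq hp2 n)
    (P := P - mirimanoffPoly θ a n) (R := OL p L)
    (by rw [map_sub, hPe, aeval_mirimanoffPoly hp2, sub_self])
  have h1 : M - (mirimanoffPoly θ a n : PowerSeries (OL p L)) =
      (M - (P : PowerSeries (OL p L))) +
        ((1 + PowerSeries.X) ^ p ^ n - 1) * (Q : PowerSeries (OL p L)) := by
    have h2 := congrArg (fun A : (OL p L)[X] => (A : PowerSeries (OL p L))) hQ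
    simp only [coe_sub, coe_mul, coe_omegaPoly] at h2
    linear_combination h2
  rw [h1]
  exact dvd_add hP (dvd_mul_right _ _)

theorem existsUnique_isMirimanoffSeries [Algebra ℚ_[p] L] [FiniteDimensional ℚ_[p] L]
    [IsScalarTower ℤ_[p] ℚ_[p] L] (hp2 : p ≠ 2) (θ : DeltaChar p) {a : OL p L}
    (ha : ∀ n, IsUnit (a ^ p ^ (n + 1) - 1)) :
    ∃! M : PowerSeries (OL p L), IsMirimanoffSeries θ a M := by
  simp only [isMirimanoffSeries_iff hp2]
  obtain ⟨τ, _, _, _⟩ := exists_compact_topology_OL (p := p) (L := L)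
  obtain ⟨f, hf⟩ := exists_forall_omega_dvd_sub (mirimanoffPoly θ a)
    (omegaPoly_dvd_mirimanoffPoly_sub hp2 θ ha)
  have := charZero_OL p L
  refine ⟨f, hf, fun g hg => sub_eq_zero.1 (eq_zero_of_forall_omega_dvd (p := p)
    eq_zero_of_forall_pow_dvd fun n => ?_)⟩
  have := dvd_sub (hg n) (hf n)
  rwa [sub_sub_sub_cancel_right] at this

end MirimanoffPolynomial

/-! ### The derivative modulo the uniformizer -/

section Derivative

variable {p : ℕ} [Fact p.Prime]

theorem finite_pow_eq_one (p : ℕ) [Fact p.Prime] : {η : ℤ_[p]ˣ | η ^ (p - 1) = 1}.Finite := by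
  have : NeZero (p - 1) := ⟨by have := (Fact.out : p.Prime).two_le; omega⟩
  have : Finite (rootsOfUnity (p - 1) ℤ_[p]) := inferInstance
  exact this

/-- The group `μ_{p-1}` of Teichmüller representatives, as a finite set of units of `ℤ_p`. -/
def teichSet (p : ℕ) [Fact p.Prime] : Finset ℤ_[p]ˣ := (finite_pow_eq_one p).toFinset

theorem mem_teichSet {η : ℤ_[p]ˣ} : η ∈ teichSet p ↔ η ^ (p - 1) = 1 := by
  simp [teichSet]

theorem one_mem_teichSet : (1 : ℤ_[p]ˣ) ∈ teichSet p := mem_teichSet.2 (one_pow _)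

theorem neg_mem_teichSet (hp2 : p ≠ 2) {η : ℤ_[p]ˣ} (hη : η ∈ teichSet p) : -η ∈ teichSet p := by
  rw [mem_teichSet] at hη ⊢
  rwa [((Fact.out : p.Prime).even_sub_one hp2).neg_pow]

theorem eq_one_or_neg_one_of_rat {η : ℤ_[p]ˣ} (hη : η ∈ teichSet p) {q : ℚ}
    (hq : (q : ℚ_[p]) = ((η : ℤ_[p]) : ℚ_[p])) : η = 1 ∨ η = -1 := by
  have hp := (Fact.out : p.Prime).two_le
  have h1 : (q : ℚ_[p]) ^ (p - 1) = 1 := by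
    rw [hq, ← PadicInt.coe_pow, ← Units.val_pow_eq_pow_val, mem_teichSet.1 hη, Units.val_one,
      PadicInt.coe_one]
  have h2 : q ^ (p - 1) = 1 := by exact_mod_cast h1
  rcases pow_eq_one_iff_cases.1 h2 with h | rfl | ⟨rfl, -⟩
  · omega
  · left
    refine Units.ext (Subtype.ext ?_)
    rw [← hq]
    simp
  · right
    refine Units.ext (Subtype.ext ?_)
    rw [← hq]
    simp

theorem neg_one_ne_one : (-1 : ℤ_[p]ˣ) ≠ 1 := by
  intro h
  have h1 : (-1 : ℤ_[p]) = 1 := by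
    have := congrArg Units.val h
    simpa using this
  have h2 : (2 : ℤ_[p]) = 0 := by linear_combination -h1
  exact two_ne_zero h2

/-- For `z ≡ (1 + p)^i mod p^{n+1}`, the residues `k` prime to `p` with `⟨k⟩ ≡ (1 + p)^i` are the
residues of `η z` for `η ∈ μ_{p-1}`, where `η = ω(k)`. -/
theorem sum_filter_expo_eq (hp2 : p ≠ 2) {n i : ℕ} (hi : i < p ^ n) {z : ℤ_[p]}
    (hz : (p : ℤ_[p]) ^ (n + 1) ∣ z - (1 + p) ^ i) {M : Type*} [AddCommMonoid M] (θ : DeltaChar p)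
    (g : ℕ → ℤ_[p] → M) (hg : ∀ k, g k 0 = 0) :
    ∑ k ∈ Finset.range (p ^ (n + 1)) with expo p n k = i, g k (weight θ k) =
      ∑ η ∈ teichSet p, g (PadicInt.toZModPow (n + 1) ((η : ℤ_[p]) * z)).val
        ((charVal θ η * η⁻¹ : ℤ_[p]ˣ) : ℤ_[p]) := by
  classical
  have hp : p.Prime := Fact.out
  have hN : NeZero (p ^ (n + 1)) := ⟨pow_ne_zero _ hp.ne_zero⟩
  have hpN : (p : ℤ_[p]) ∣ (p : ℤ_[p]) ^ (n + 1) := dvd_pow_self _ n.succ_ne_zero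
  have hz1 : (p : ℤ_[p]) ∣ z - 1 := by
    have h1 := sub_dvd_pow_sub_pow (1 + p : ℤ_[p]) 1 i
    rw [add_sub_cancel_left, one_pow] at h1
    have := dvd_add (hpN.trans hz) h1
    rwa [sub_add_sub_cancel] at this
  have hval : ∀ η : ℤ_[p]ˣ, (p : ℤ_[p]) ^ (n + 1) ∣
      (((PadicInt.toZModPow (n + 1) ((η : ℤ_[p]) * z)).val : ℕ) : ℤ_[p]) - η * z := fun η => by
    rw [← toZModPow_eq_iff_dvd, map_natCast, ZMod.natCast_zmod_val]
  have hval1 : ∀ η : ℤ_[p]ˣ, (p : ℤ_[p]) ∣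
      (((PadicInt.toZModPow (n + 1) ((η : ℤ_[p]) * z)).val : ℕ) : ℤ_[p]) - η := fun η => by
    have := dvd_add (hpN.trans (hval η)) (hz1.mul_left (η : ℤ_[p]))
    rwa [mul_sub, mul_one, sub_add_sub_cancel] at this
  have hndvd : ∀ η : ℤ_[p]ˣ, ¬ p ∣ (PadicInt.toZModPow (n + 1) ((η : ℤ_[p]) * z)).val := by
    rintro η ⟨k, hk⟩
    have h1 := hval1 η
    rw [hk, Nat.cast_mul, dvd_sub_right (dvd_mul_right _ _)] at h1
    exact PadicInt.prime_p.not_isUnit (isUnit_of_dvd_unit h1 η.isUnit)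
  have hteich : ∀ η ∈ teichSet p, teich p (natUnit p _ (hndvd η)) = η := fun η hη =>
    teich_eq_of_congr (mem_teichSet.1 hη) (hval1 η)
  have hfil : ∑ k ∈ Finset.range (p ^ (n + 1)) with expo p n k = i, g k (weight θ k) =
      ∑ k ∈ Finset.range (p ^ (n + 1)) with (¬ p ∣ k ∧ expo p n k = i), g k (weight θ k) := by
    symm
    refine Finset.sum_subset (fun k hk => ?_) fun k hk hk' => ?_
    · rw [Finset.mem_filter] at hk ⊢
      exact ⟨hk.1, hk.2.2⟩
    · rw [Finset.mem_filter] at hk hk'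
      have : p ∣ k := by
        by_contra h
        exact hk' ⟨hk.1, h, hk.2⟩
      rw [weight, dif_pos this, hg]
  rw [hfil]
  have hbwd : ∀ k (hk : ¬ p ∣ k), k < p ^ (n + 1) → expo p n k = i →
      (PadicInt.toZModPow (n + 1) ((teich p (natUnit p k hk) : ℤ_[p]) * z)).val = k := by
    intro k hk hkN hki
    have h1 := (expo_eq_iff hp2 n hk hi).1 hki
    have h2 : (p : ℤ_[p]) ^ (n + 1) ∣ (teich p (natUnit p k hk) : ℤ_[p]) * z - (k : ℤ_[p]) := by
      have h3 : (k : ℤ_[p]) = teich p (natUnit p k hk) * angle p (natUnit p k hk) := by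
        rw [← Units.val_mul, teich_mul_angle]; rfl
      rw [h3, ← mul_sub]
      have h4 := dvd_sub hz h1
      rw [sub_sub_sub_cancel_right] at h4
      exact h4.mul_left _
    rw [(toZModPow_eq_iff_dvd _ _ _).2 h2, map_natCast, ZMod.val_natCast_of_lt hkN]
  refine Finset.sum_bij' (fun k hk => teich p (natUnit p k (Finset.mem_filter.1 hk).2.1))
    (fun η _ => (PadicInt.toZModPow (n + 1) ((η : ℤ_[p]) * z)).val) ?_ ?_ ?_ ?_ ?_
  · exact fun k hk => mem_teichSet.2 (teich_pow _)
  · intro η hη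
    rw [Finset.mem_filter, Finset.mem_range]
    refine ⟨ZMod.val_lt _, hndvd η, (expo_eq_iff hp2 n (hndvd η) hi).2 ?_⟩
    have h1 : (angle p (natUnit p _ (hndvd η)) : ℤ_[p]) - z = ((η⁻¹ : ℤ_[p]ˣ) : ℤ_[p]) *
        ((((PadicInt.toZModPow (n + 1) ((η : ℤ_[p]) * z)).val : ℕ) : ℤ_[p]) - η * z) := by
      rw [angle, hteich η hη, mul_sub, Units.inv_mul_cancel_left]
      rfl
    have h2 := dvd_add ((hval η).mul_left ((η⁻¹ : ℤ_[p]ˣ) : ℤ_[p])) hz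
    rwa [← h1, sub_add_sub_cancel] at h2
  · intro k hk
    rw [Finset.mem_filter, Finset.mem_range] at hk
    exact hbwd k hk.2.1 hk.1 hk.2.2
  · exact fun η hη => hteich η hη
  · intro k hk
    rw [Finset.mem_filter, Finset.mem_range] at hk
    rw [hbwd k hk.2.1 hk.1 hk.2.2, weight, dif_neg hk.2.1, charVal_teich]

theorem C_dvd_iff_map_eq_zero {R k : Type*} [CommRing R] [CommRing k] {π : R} {κ : R →+* k}
    (hκ : ∀ x, κ x = 0 ↔ π ∣ x) (f : PowerSeries R) :
    PowerSeries.C π ∣ f ↔ PowerSeries.map κ f = 0 := by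
  constructor
  · rintro ⟨g, rfl⟩
    rw [map_mul, PowerSeries.map_C, (hκ π).2 dvd_rfl, map_zero, zero_mul]
  · intro h
    have h1 : ∀ d, π ∣ PowerSeries.coeff d f := fun d => by
      rw [← hκ, ← PowerSeries.coeff_map, h, map_zero]
    choose g hg using h1
    refine ⟨PowerSeries.mk g, ?_⟩
    ext d
    rw [PowerSeries.coeff_C_mul, PowerSeries.coeff_mk, hg]

theorem map_derivative_powerSeries {R k : Type*} [CommRing R] [CommRing k] (κ : R →+* k)
    (f : PowerSeries R) : PowerSeries.map κ (PowerSeries.derivative R f) =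
      PowerSeries.derivative k (PowerSeries.map κ f) := by
  ext d
  simp [PowerSeries.coeff_derivative]

variable {L : Type*} [Field L] [Algebra ℤ_[p] L]

/-- `M'(T, θ, a) ≡ 0 mod π` means that, modulo `π`, only the group elements `γ_0^i` with `p ∣ i`
occur in `M_n(θ, a)`; the coefficient of `γ_0^i` is a sum over `μ_{p-1}`. -/
theorem C_dvd_derivative_iff (hp2 : p ≠ 2) {k : Type*} [Field k] [CharP k p] {π : OL p L}
    {κ : OL p L →+* k} (hκ : ∀ x, κ x = 0 ↔ π ∣ x) (θ : DeltaChar p) {a : OL p L}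
    (ha : ∀ n, IsUnit (a ^ p ^ (n + 1) - 1)) {M : PowerSeries (OL p L)}
    (hM : IsMirimanoffSeries θ a M) :
    PowerSeries.C π ∣ PowerSeries.derivative (OL p L) M ↔
      ∀ n ≠ 0, ∀ i < p ^ n, ¬ p ∣ i → ∀ z : ℤ_[p], (p : ℤ_[p]) ^ (n + 1) ∣ z - (1 + p) ^ i →
        ∑ η ∈ teichSet p,
          κ (algebraMap ℤ_[p] (OL p L) ((charVal θ η * η⁻¹ : ℤ_[p]ˣ) : ℤ_[p])) *
            κ a ^ (PadicInt.toZModPow (n + 1) ((η : ℤ_[p]) * z)).val = 0 := by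
  classical
  let c : ℕ → ℕ → k := fun n i =>
    ∑ k ∈ Finset.range (p ^ (n + 1)) with expo p n k = i, κ (mirimanoffCoeff θ a n k)
  have hpoly : ∀ n, (mirimanoffPoly θ a n).map κ =
      ∑ i ∈ Finset.range (p ^ n), C (c n i) * (1 + X) ^ i := by
    intro n
    rw [mirimanoffPoly, Polynomial.map_sum, ← Finset.sum_fiberwise_of_maps_to
      (g := fun k => expo p n k) (t := Finset.range (p ^ n))
      fun k _ => Finset.mem_range.2 (expo_lt n k)]
    refine Finset.sum_congr rfl fun i _ => ?_
    rw [map_sum, Finset.sum_mul]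
    refine Finset.sum_congr rfl fun k hk => ?_
    rw [(Finset.mem_filter.1 hk).2]
    simp
  have hF : ∀ n, ((1 + PowerSeries.X) ^ p ^ n - 1 : PowerSeries k) ∣ PowerSeries.map κ M -
      ((∑ i ∈ Finset.range (p ^ n), C (c n i) * (1 + X) ^ i : k[X]) : PowerSeries k) := by
    intro n
    have h1 := map_dvd (PowerSeries.map κ) ((isMirimanoffSeries_iff hp2 θ a M).1 hM n)
    rw [map_sub, map_sub, map_pow, map_add, map_one, PowerSeries.map_X,
      ← Polynomial.polynomial_map_coe, hpoly] at h1
    exact h1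
  rw [C_dvd_iff_map_eq_zero hκ, map_derivative_powerSeries, derivative_eq_zero_iff c hF]
  refine forall_congr' fun n => imp_congr_right fun hn => forall_congr' fun i =>
    imp_congr_right fun hi => imp_congr_right fun hpi => ?_
  have hinv : κ (Ring.inverse (a ^ p ^ (n + 1) - 1)) ≠ 0 := by
    have h1 := congrArg κ (Ring.mul_inverse_cancel _ (ha n))
    rw [map_mul, map_one] at h1
    exact right_ne_zero_of_mul_eq_one h1
  have hc : ∀ z : ℤ_[p], (p : ℤ_[p]) ^ (n + 1) ∣ z - (1 + p) ^ i →
      c n i = κ (Ring.inverse (a ^ p ^ (n + 1) - 1)) * ∑ η ∈ teichSet p,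
          κ (algebraMap ℤ_[p] (OL p L) ((charVal θ η * η⁻¹ : ℤ_[p]ˣ) : ℤ_[p])) *
            κ a ^ (PadicInt.toZModPow (n + 1) ((η : ℤ_[p]) * z)).val := by
    intro z hz
    have h1 := sum_filter_expo_eq hp2 hi hz θ (fun m w =>
      κ (a ^ m * Ring.inverse (a ^ p ^ (n + 1) - 1) * algebraMap ℤ_[p] (OL p L) w)) (by simp)
    simp only [c, mirimanoffCoeff, h1, Finset.mul_sum]
    refine Finset.sum_congr rfl fun η _ => ?_
    rw [map_mul, map_mul, map_pow]
    ring
  constructor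
  · intro h z hz
    rw [hc z hz] at h
    exact (mul_eq_zero.1 h).resolve_left hinv
  · intro h
    have hz : (p : ℤ_[p]) ^ (n + 1) ∣ (1 + p) ^ i - (1 + p : ℤ_[p]) ^ i := by
      rw [sub_self]; exact dvd_zero _
    rw [hc _ hz, h _ hz, mul_zero]

end Derivative

/-! ### The vanishing criterion -/

section Criterion

variable {p : ℕ} [Fact p.Prime]

theorem toZModPow_unit_ne_zero {N : ℕ} (hN : N ≠ 0) {z : ℤ_[p]} (hz : ¬ (p : ℤ_[p]) ∣ z) :
    PadicInt.toZModPow N z ≠ 0 := by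
  intro h
  rw [← map_zero (PadicInt.toZModPow N : ℤ_[p] →+* ZMod (p ^ N)), toZModPow_eq_iff_dvd,
    sub_zero] at h
  exact hz ((dvd_pow_self _ hN).trans h)

/-- `[-z] = p^N - [z]` has the opposite parity of `[z]`. -/
theorem neg_one_pow_val_neg {k : Type*} [CommRing k] (hp2 : p ≠ 2) {N : ℕ} (hN : N ≠ 0)
    {z : ℤ_[p]} (hz : ¬ (p : ℤ_[p]) ∣ z) :
    (-1 : k) ^ (PadicInt.toZModPow N (-z)).val = -(-1) ^ (PadicInt.toZModPow N z).val := by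
  have hp : p.Prime := Fact.out
  have : NeZero (p ^ N) := ⟨pow_ne_zero _ hp.ne_zero⟩
  have : NeZero (PadicInt.toZModPow N z) := ⟨toZModPow_unit_ne_zero hN hz⟩
  have hlt := (ZMod.val_lt (PadicInt.toZModPow N z)).le
  have hodd : Odd (p ^ N) := (hp.odd_of_ne_two hp2).pow
  rw [map_neg, ZMod.val_neg_of_ne_zero]
  rcases Nat.even_or_odd (PadicInt.toZModPow N z).val with h | h
  · rw [h.neg_one_pow, (Nat.Odd.sub_even hlt hodd h).neg_one_pow]
  · rw [h.neg_one_pow, (Nat.Odd.sub_odd hodd h).neg_one_pow, neg_neg]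

theorem not_dvd_unit_mul {z : ℤ_[p]} (η : ℤ_[p]ˣ) (hz : (p : ℤ_[p]) ∣ z - 1) :
    ¬ (p : ℤ_[p]) ∣ η * z := by
  intro h
  have h1 : (p : ℤ_[p]) ∣ z := (Units.dvd_mul_left).1 h
  exact PadicInt.prime_p.not_dvd_one ((dvd_sub_right h1).1 hz)

variable {k : Type*} [Field k]

/-- For `α = -1` and even coefficients `c` the terms of `η` and `-η` cancel. -/
theorem sum_eq_zero_of_even (hp2 : p ≠ 2) {N : ℕ} (hN : N ≠ 0) {z : ℤ_[p]}
    (hz : (p : ℤ_[p]) ∣ z - 1) {c : ℤ_[p]ˣ → k} (hc : ∀ η, c (-η) = c η) :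
    ∑ η ∈ teichSet p, c η * (-1) ^ (PadicInt.toZModPow N ((η : ℤ_[p]) * z)).val = 0 := by
  refine Finset.sum_involution (fun η _ => -η) (fun η _ => ?_) (fun η _ _ h => ?_)
    (fun η hη => neg_mem_teichSet hp2 hη) fun η _ => neg_neg η
  · rw [hc, Units.val_neg, neg_mul, neg_one_pow_val_neg hp2 hN (not_dvd_unit_mul η hz)]
    ring
  · have h1 : η * -1 = η * 1 := by rw [mul_neg, mul_one, h]
    exact neg_one_ne_one (p := p) (mul_left_cancel h1)

/-- For `α = -1` the functions `z ↦ α^{[η z]}` of `η = 1` and `η = -1` are opposite, so only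
`c 1 - c (-1)` is seen by the independence of `coeff_one_eq_zero`. -/
theorem eq_neg_one_of_sum_eq_zero (hp2 : p ≠ 2) [CharP k p] {α : k} (hα0 : α ≠ 0) (hα1 : α ≠ 1)
    {c : ℤ_[p]ˣ → k} (hc : c 1 ≠ 0)
    (H : ∀ N ≥ 2, ∀ z : ℤ_[p], (p : ℤ_[p]) ^ 2 ∣ z - (1 + p) →
      ∑ η ∈ teichSet p, c η * α ^ (PadicInt.toZModPow N ((η : ℤ_[p]) * z)).val = 0) :
    α = -1 ∧ c (-1) = c 1 := by
  classical
  have hrat : ∀ η ∈ teichSet p, η ≠ 1 → η ≠ -1 → ∀ q : ℚ, (q : ℚ_[p]) ≠ ((η : ℤ_[p]) : ℚ_[p]) :=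
    fun η hη h1 h2 q hq => (eq_one_or_neg_one_of_rat hη hq).elim h1 h2
  have hα : α = -1 := by
    have h2 : α ^ 2 = 1 := by
      by_contra h2
      refine hc (coeff_one_eq_zero hα0 hα1 2 (1 + p) (teichSet p) c one_mem_teichSet ?_ H)
      intro η hη h1
      by_cases h3 : η = -1
      · exact Or.inr ⟨h3, h2⟩
      · exact Or.inl (hrat η hη h1 h3)
    exact (sq_eq_one_iff.1 h2).resolve_left hα1
  refine ⟨hα, ?_⟩
  subst hα
  have hne := neg_one_ne_one (p := p)
  have hmem : (-1 : ℤ_[p]ˣ) ∈ teichSet p := neg_mem_teichSet hp2 one_mem_teichSet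
  have hmem1 : (1 : ℤ_[p]ˣ) ∈ (teichSet p).erase (-1) :=
    Finset.mem_erase.2 ⟨hne.symm, one_mem_teichSet⟩
  have h0 := coeff_one_eq_zero hα0 hα1 2 (1 + p) ((teichSet p).erase (-1))
    (fun η => if η = 1 then c 1 - c (-1) else c η) hmem1 (fun η hη h1 =>
      Or.inl (hrat η (Finset.mem_of_mem_erase hη) h1 (Finset.ne_of_mem_erase hη))) ?_
  · rw [if_pos rfl, sub_eq_zero] at h0
    exact h0.symm
  · intro N hN z hz
    have hz1 : (p : ℤ_[p]) ∣ z - 1 := by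
      have := dvd_add ((dvd_pow_self _ two_ne_zero).trans hz) (dvd_refl (p : ℤ_[p]))
      rwa [sub_add_eq_sub_sub, sub_add_cancel] at this
    have h1 := H N hN z hz
    rw [← Finset.add_sum_erase _ _ hmem, ← Finset.add_sum_erase _ _ hmem1, Units.val_neg, neg_mul,
      neg_one_pow_val_neg hp2 (by omega) (not_dvd_unit_mul 1 hz1)] at h1
    rw [← Finset.add_sum_erase _ _ hmem1, if_pos rfl, Finset.sum_congr rfl fun η hη => by
      rw [if_neg (Finset.ne_of_mem_erase hη)]]
    linear_combination h1

end Criterion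

end Mirimanoff

end

theorem theorem3p3 (p : ℕ) [Fact p.Prime] (hp : 5 ≤ p)
    (L : Type*) [Field L] [Algebra ℚ_[p] L] [FiniteDimensional ℚ_[p] L]
    [Algebra ℤ_[p] L] [IsScalarTower ℤ_[p] ℚ_[p] L]
    (π : Mirimanoff.OL p L) (hπ : Irreducible π)
    (θ : Mirimanoff.DeltaChar p)
    (a : Mirimanoff.OL p L) (ha : ¬ π ∣ a * (a - 1)) :
    (∃! M : PowerSeries (Mirimanoff.OL p L), Mirimanoff.IsMirimanoffSeries θ a M) ∧
    ∀ M : PowerSeries (Mirimanoff.OL p L), Mirimanoff.IsMirimanoffSeries θ a M →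
      (PowerSeries.C π ∣ PowerSeries.derivative (Mirimanoff.OL p L) M ↔
        π ∣ a + 1 ∧ Mirimanoff.IsOdd θ) := by
  open Mirimanoff in
  have hp2 : p ≠ 2 := by omega
  have hpr : p.Prime := Fact.out
  have hmax := isMaximal_span_of_irreducible hπ
  let k := OL p L ⧸ Ideal.span {π}
  let _ : Field k := Ideal.Quotient.field _
  let κ : OL p L →+* k := Ideal.Quotient.mk _
  have hκ : ∀ x, κ x = 0 ↔ π ∣ x := fun x => by
    rw [Ideal.Quotient.eq_zero_iff_mem, Ideal.mem_span_singleton]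
  have hpk : (p : k) = 0 := by
    rw [← map_natCast κ, hκ]
    exact dvd_natCast hπ
  have hchar : CharP k p := (CharP.charP_iff_prime_eq_zero hpr).2 hpk
  have h01 : κ a ≠ 0 ∧ κ a ≠ 1 := by
    rw [← hκ, map_mul, map_sub, map_one, mul_eq_zero, not_or, sub_eq_zero] at ha
    exact ha
  have hunit : ∀ n, IsUnit (a ^ p ^ (n + 1) - 1) := fun n => by
    rw [isUnit_iff_not_dvd hπ, ← hκ, map_sub, map_pow, map_one]
    exact fun h => h01.2 ((pow_prime_pow_eq_one_iff (n + 1)).1 (sub_eq_zero.1 h))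
  refine ⟨existsUnique_isMirimanoffSeries hp2 θ hunit, fun M hM => ?_⟩
  rw [C_dvd_derivative_iff hp2 hκ θ hunit hM]
  -- the residue of `θω⁻¹`, as a function on `μ_{p-1}`
  set c : ℤ_[p]ˣ → k := fun η =>
    κ (algebraMap ℤ_[p] (OL p L) ((charVal θ η * η⁻¹ : ℤ_[p]ˣ) : ℤ_[p])) with hc
  have hc1 : c 1 = 1 := by simp [hc, charVal_one]
  have hcneg : ∀ η, charVal θ (-1) = -1 → c (-η) = c η := by
    intro η h
    simp only [hc]
    rw [← neg_one_mul, charVal_mul, h, mul_inv, inv_neg, inv_one]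
    simp
  constructor
  · intro h
    obtain ⟨h1, h2⟩ := eq_neg_one_of_sum_eq_zero hp2 h01.1 h01.2 (c := c) (by rw [hc1]; exact one_ne_zero) (by
      intro N hN z hz
      obtain ⟨n, rfl⟩ : ∃ n, N = n + 1 := ⟨N - 1, by omega⟩
      have hz1 : (p : ℤ_[p]) ∣ z - 1 := by
        have := dvd_add ((dvd_pow_self _ two_ne_zero).trans hz) (dvd_refl (p : ℤ_[p]))
        rwa [sub_add_eq_sub_sub, sub_add_cancel] at this
      obtain ⟨i, hi, hzi⟩ := exists_pow_eq_of_congr_one hp2 n z hz1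
      have hzi' : (p : ℤ_[p]) ^ (n + 1) ∣ z - (1 + p) ^ i := by
        rw [← toZModPow_eq_iff_dvd, hzi]
        simp
      refine h n (by omega) i hi ?_ z hzi'
      -- `(1 + p)^i ≡ 1 + p mod p^2` forces `i ≡ 1 mod p`
      have h3 := dvd_sub hz ((pow_dvd_pow _ hN).trans hzi')
      rw [sub_sub_sub_cancel_left, ← pow_one (1 + p : ℤ_[p]), ← pow_mul, one_mul,
        one_add_p_pow_sub_dvd_iff hp2 1, pow_one] at h3
      intro hpi
      exact hpr.one_lt.ne' (Nat.dvd_one.1 ((h3.dvd_iff dvd_rfl).1 hpi)))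
    refine ⟨?_, ?_⟩
    · rw [← hκ, map_add, map_one, h1, neg_add_cancel]
    · have h3 : charVal θ (-1) * charVal θ (-1) = 1 := by
        rw [← charVal_mul, neg_mul_neg, one_mul, charVal_one]
      rcases mul_self_eq_one_iff.1 (congrArg Units.val h3 : (charVal θ (-1) : ℤ_[p]) *
        (charVal θ (-1) : ℤ_[p]) = 1) with h4 | h4
      · exfalso
        have h5 : charVal θ (-1) = 1 := Units.ext h4
        have h6 : c (-1) = -1 := by simp [hc, h5]
        rw [h6, hc1] at h2
        have h7 : ((2 : ℕ) : k) = 0 := by push_cast; linear_combination -h2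
        have := (CharP.cast_eq_zero_iff k p 2).1 h7
        exact hp2 ((Nat.prime_dvd_prime_iff_eq hpr Nat.prime_two).1 this)
      · exact Units.ext h4
  · rintro ⟨h1, h2⟩ n hn i hi hpi z hz
    have hα : κ a = -1 := by
      rw [← hκ, map_add, map_one] at h1
      exact eq_neg_of_add_eq_zero_left h1
    rw [hα]
    refine sum_eq_zero_of_even hp2 n.succ_ne_zero ?_ fun η => hcneg η h2
    have h3 := sub_dvd_pow_sub_pow (1 + p : ℤ_[p]) 1 i
    rw [add_sub_cancel_left, one_pow] at h3
    have := dvd_add ((dvd_pow_self _ n.succ_ne_zero).trans hz) h3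
    rwa [sub_add_sub_cancel] at this
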